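/- All graphs are finite and simple. For a graph $H$ with independence number $\alpha_H$ put $\gamma_H=|H|-\alpha_H-1$, and for a non-empty family $\mathbb{H}$ of graphs put $\gamma_{\mathbb{H}}=\min_{H\in\mathbb{H}}\gamma_H$. A subdivision of $H$ is a graph obtained from $H$ by replacing some edges by internally vertex-disjoint paths. A graph is $\mathbb{H}$-subdivision-free if it contains no subdivision of any $H\in\mathbb{H}$ as a subgraph. It is $\mathbb{H}$-subdivision-saturated if it is $\mathbb{H}$-subdivision-free but the addition of any new edge creates a subdivision of some $H\in\mathbb{H}$. Let $B_{s,t}=K_s\vee tK_1$ be the join of an $s$-clique and $t$ independent vertices. The spectral radius of a graph is the largest modulus of an eigenvalue of its adjacency matrix, and $\mathrm{SPEX}(n,\mathbb{H}_{\rm sub})$ is the set of $n$-vertex $\mathbb{H}$-subdivision-free graphs of maximum spectral radius. (1) Let $\mathbb{H}$ be a non-empty family of graphs with $\gamma_{\mathbb{H}}\ge 1$. There is an integer $N=N(\mathbb{H})$ such that for every $n\ge N$: if $B_{\gamma_{\mathbb{H}},\,n-\gamma_{\mathbb{H}}}$ is $\mathbb{H}$-subdivision-saturated, then, up to isomorphism,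 $B_{\gamma_{\mathbb{H}},\,n-\gamma_{\mathbb{H}}}$ is the unique member of $\mathrm{SPEX}(n,\mathbb{H}_{\rm sub})$. (2) Let $\mathbb{H}$ be a non-empty family consisting of cliques $K_r$ ($r\in R$), odd cycles $C_{2\ell+1}$ ($\ell\in L$) and paths $P_{2k}$ on $2k$ vertices ($k\in K$), where $R,L,K$ are sets of integers (some of them possibly empty), $r\ge 3$ for all $r\in R$, $\ell\ge 1$ for all $\ell\in L$, and $k\ge 2$ for all $k\in K$. Then $$\gamma_{\mathbb{H}}=\min\bigl(\{r-2: r\in R\}\cup L\cup\{k-1:k\in K\}\bigr),$$ and for all sufficiently large $n$ the graph $B_{\gamma_{\mathbb{H}},\,n-\gamma_{\mathbb{H}}}$ is $\mathbb{H}$-subdivision-saturated and, up to isomorphism, is the unique member of $\mathrm{SPEX}(n,\mathbb{H}_{\rm sub})$. -/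

import Mathlib

/-- A model of `H` in `G`: an injective choice of branch vertices in `G` for the vertices of `H`,
and, for every edge `uv` of `H`, a path of `G` joining the branch vertices of `u` and `v` (the same
path, reversed, for `vu`), such that no branch vertex is an internal vertex of any of these paths
and the paths of distinct edges are internally vertex-disjoint. -/
structure SubdivisionModel {W V : Type*} (H : SimpleGraph W) (G : SimpleGraph V) where
  /-- the branch vertices -/
  branch : W ↪ V
  /-- the path that replaces an edge of `H` -/
  path : ∀ u v : W, H.Adj u v → G.Walk (branch u) (branch v)
  isPath : ∀ u v (h : H.Adj u v), (path u v h).IsPath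
  path_symm : ∀ u v (h : H.Adj u v), path v u h.symm = (path u v h).reverse
  branch_mem : ∀ u v (h : H.Adj u v) (w : W), branch w ∈ (path u v h).support → w = u ∨ w = v
  /-- Paths of distinct edges meet only in branch vertices, which by the previous field are common
  end vertices of the two paths. -/
  disjoint : ∀ u v (h : H.Adj u v) u' v' (h' : H.Adj u' v'), s(u, v) ≠ s(u', v') →
    ∀ x, x ∈ (path u v h).support → x ∈ (path u' v' h').support → x ∈ Set.range branch

/-- `T` is a subdivision of `H`: it arises from `H` by replacing edges by internally
vertex-disjoint paths (a path of length one leaves the edge unchanged). So `T` has a model of `H`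
such that every vertex of `T` is a branch vertex or lies on one of the paths, and every edge of `T`
belongs to one of the paths. -/
def IsSubdivision {W V : Type*} (H : SimpleGraph W) (T : SimpleGraph V) : Prop :=
  ∃ M : SubdivisionModel H T,
    (∀ x : V, x ∈ Set.range M.branch ∨ ∃ u v, ∃ h : H.Adj u v, x ∈ (M.path u v h).support) ∧
    (∀ e ∈ T.edgeSet, ∃ u v, ∃ h : H.Adj u v, e ∈ (M.path u v h).edges)

/-- `G` contains a subdivision of `H` as a (not necessarily induced) subgraph. -/
def ContainsSubdivision {W V : Type*} (H : SimpleGraph W) (G : SimpleGraph V) : Prop :=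
  ∃ T : G.Subgraph, IsSubdivision H T.coe

/-- A finite simple graph, with vertex set `{0, …, m - 1}`. Every finite graph is isomorphic to
one of this form. -/
abbrev FinGraph : Type := Σ m : ℕ, SimpleGraph (Fin m)

/-- `G` contains no subdivision of any member of the family `F`. -/
def SubdivisionFree {V : Type*} (F : Set FinGraph) (G : SimpleGraph V) : Prop :=
  ∀ H ∈ F, ¬ ContainsSubdivision H.2 G

/-- `G` is `F`-subdivision-free, but adding any new edge creates a subdivision of a member
of `F`. -/
def SubdivisionSaturated {V : Type*} (F : Set FinGraph) (G : SimpleGraph V) : Prop :=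
  SubdivisionFree F G ∧
    ∀ u v : V, u ≠ v → ¬ G.Adj u v →
      ∃ H ∈ F, ContainsSubdivision H.2 (G ⊔ SimpleGraph.edge u v)

/-- The number `|H| - α(H) - 1`. (As a natural number it is truncated to `0` when `H` has no edge,
where the integer would be `-1`; this does not affect the condition that it be at least `1`.) -/
noncomputable def graphGamma (H : FinGraph) : ℕ := H.1 - H.2.indepNum - 1

/-- The minimum of `|H| - α(H) - 1` over the members `H` of the family `F`
(and `0` if `F` is empty). -/
noncomputable def familyGamma (F : Set FinGraph) : ℕ := sInf (graphGamma '' F)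

/-- The generalized book `K_s ∨ t K_1`: the join of an `s`-clique and `t` independent vertices. -/
def generalizedBook (s t : ℕ) : SimpleGraph (Fin s ⊕ Fin t) where
  Adj x y := x ≠ y ∧ (x.isLeft ∨ y.isLeft)
  symm.symm _ _ h := ⟨h.1.symm, h.2.symm⟩
  loopless.irrefl _ h := h.1 rfl

open Classical in
/-- The spectral radius of a graph: the largest modulus of an eigenvalue of its adjacency matrix
(a real symmetric matrix, so that all its eigenvalues are real). -/
noncomputable def graphSpectralRadius {V : Type*} [Fintype V] (G : SimpleGraph V) : ENNReal :=
  spectralRadius ℝ (G.adjMatrix ℝ)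

/-- The `F`-subdivision-free graphs on `n` vertices that have the maximum spectral radius. -/
def spexSub (n : ℕ) (F : Set FinGraph) : Set (SimpleGraph (Fin n)) :=
  {G | SubdivisionFree F G ∧
    ∀ G' : SimpleGraph (Fin n), SubdivisionFree F G' →
      graphSpectralRadius G' ≤ graphSpectralRadius G}

/-- The family of the cliques `K_r`, `r ∈ R`, the odd cycles `C_{2ℓ+1}`, `ℓ ∈ L`, and the paths
`P_{2k}` with `2k` vertices, `k ∈ K`. -/
def cliqueCyclePathFamily (R L K : Set ℕ) : Set FinGraph :=
  (fun r : ℕ => (⟨r, SimpleGraph.completeGraph (Fin r)⟩ : FinGraph)) '' R ∪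
  (fun l : ℕ => (⟨2 * l + 1, SimpleGraph.cycleGraph (2 * l + 1)⟩ : FinGraph)) '' L ∪
  (fun k : ℕ => (⟨2 * k, SimpleGraph.pathGraph (2 * k)⟩ : FinGraph)) '' K

/-! Write γ for γ_𝔽 and B for the book with γ spine vertices on n vertices. Let H₀ in the family
attain γ, and let G be subdivision-free with spectral radius ρ at least that of B. Three
consequences of freeness drive the proof. G is sparse: every vertex set S spans at most D|S| ordered
adjacent pairs, since linear density forces a subdivision of H₀ (`nonempty_of_dense`). G has no γ+1
vertices with t common neighbours, since H₀ lies in a book with γ+1 spine vertices. Once γ vertices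
have many common neighbours, saturation of a single book makes those neighbours pairwise
non-adjacent, and no vertex outside the γ is adjacent to two of them
(`not_walk_of_subdivisionFree`).

Since ρ² ≥ γ(n-γ), the first two facts locate the spine spectrally: exactly γ vertices carry large
Perron weight, all others carry weight at most ε, and the γ vertices have at least n/2 common
neighbours (`exists_dominating_set`). Pairing the Perron vector of G with the explicit eigenvector
of the book on that spine then compares the two graphs (`adj_iff_of_le_spectralRadius`): a missing
spine edge costs a constant, an edge off the spine gains only O(ε), and by sparsity and the third
fact there are only O(1) such edges per vertex not joined to the whole spine. Hence G is the book.

The book itself is subdivision-free because deleting the spine leaves an independent set and passing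
to a subdivision cannot lower the vertex cover number (`SubdivisionModel.le_add_indepNum`). For
cliques, odd cycles and paths, saturation is checked by hand: one edge between two pages creates
K_{s+2}, C_{2s+1} and P_{2s+2}, where s is the size of the spine. -/

/-! ### Models of subdivisions and their composition -/

namespace SubdivisionModel

/-- A model is obtained from walks between the branch vertices whose inner vertices lie in disjoint
sets, one for every edge. -/
theorem nonempty_of_walks {W V : Type*} {H : SimpleGraph W} {G : SimpleGraph V} (b : W ↪ V)
    (U : Sym2 W → Set V)
    (hwalk : ∀ u v, H.Adj u v →
      ∃ p : G.Walk (b u) (b v), ∀ x ∈ p.support, x = b u ∨ x = b v ∨ x ∈ U s(u, v))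
    (hb : ∀ u v, H.Adj u v → ∀ w, b w ∉ U s(u, v))
    (hd : ∀ u v u' v', H.Adj u v → H.Adj u' v' → s(u, v) ≠ s(u', v') →
      ∀ x, x ∈ U s(u, v) → x ∉ U s(u', v')) :
    Nonempty (SubdivisionModel H G) := by
  classical
  -- An arbitrary order on W orients each edge, so that the path for the opposite orientation can be
  -- defined as the reverse, as `path_symm` demands.
  let _ : LinearOrder W := linearOrderOfSTO WellOrderingRel
  have hpath : ∀ u v, H.Adj u v → ∃ p : G.Walk (b u) (b v), p.IsPath ∧
      ∀ x ∈ p.support, x = b u ∨ x = b v ∨ x ∈ U s(u, v) := by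
    intro u v h
    obtain ⟨p, hp⟩ := hwalk u v h
    exact ⟨p.bypass, p.bypass_isPath, fun x hx => hp x (p.support_bypass_subset_support hx)⟩
  choose q hq hqs using hpath
  let P : ∀ u v : W, H.Adj u v → G.Walk (b u) (b v) := fun u v h =>
    if u < v then q u v h else (q v u h.symm).reverse
  have hPs : ∀ u v (h : H.Adj u v), ∀ x ∈ (P u v h).support,
      x = b u ∨ x = b v ∨ x ∈ U s(u, v) := by
    intro u v h x hx
    by_cases huv : u < v
    · simp only [P, if_pos huv] at hx
      exact hqs u v h x hx
    · simp only [P, if_neg huv, SimpleGraph.Walk.support_reverse, List.mem_reverse] at hx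
      rw [Sym2.eq_swap]
      rcases hqs v u h.symm x hx with h1 | h1 | h1 <;> simp [h1]
  refine ⟨⟨b, P, ?_, ?_, ?_, ?_⟩⟩
  · intro u v h
    by_cases huv : u < v
    · simp only [P, if_pos huv]; exact hq u v h
    · simp only [P, if_neg huv]; exact (hq v u h.symm).reverse
  · intro u v h
    rcases lt_or_gt_of_ne h.ne with huv | huv
    · simp only [P, if_pos huv, if_neg huv.asymm]
    · simp only [P, if_pos huv, if_neg huv.asymm, SimpleGraph.Walk.reverse_reverse]
  · intro u v h w hw
    rcases hPs u v h _ hw with h1 | h1 | h1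
    · exact Or.inl (b.injective h1)
    · exact Or.inr (b.injective h1)
    · exact absurd h1 (hb u v h w)
  · intro u v h u' v' h' hne x hx hx'
    rcases hPs u v h _ hx with h1 | h1 | h1
    · exact ⟨u, h1.symm⟩
    · exact ⟨v, h1.symm⟩
    · rcases hPs u' v' h' _ hx' with h2 | h2 | h2
      · exact ⟨u', h2.symm⟩
      · exact ⟨v', h2.symm⟩
      · exact absurd h2 (hd u v u' v' h h' hne x h1)

/-- A copy of `H` in `G` is a model of `H` in `G`. -/
theorem nonempty_of_hom {W V : Type*} {H : SimpleGraph W} {G : SimpleGraph V} (f : H →g G)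
    (hf : Function.Injective f) : Nonempty (SubdivisionModel H G) := by
  refine nonempty_of_walks ⟨f, hf⟩ (fun _ => ∅) ?_ (by simp) (by simp)
  intro u v h
  exact ⟨(f.map_adj h).toWalk, by simp⟩

theorem exists_walk_lift {W V : Type*} {K : SimpleGraph W} {G : SimpleGraph V}
    (M : SubdivisionModel K G) {a c : W} (p : K.Walk a c) :
    ∃ q : G.Walk (M.branch a) (M.branch c), ∀ x ∈ q.support, x = M.branch a ∨
      ∃ u v, ∃ h : K.Adj u v, s(u, v) ∈ p.edges ∧ x ∈ (M.path u v h).support := by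
  induction p with
  | nil => exact ⟨.nil, by simp⟩
  | @cons u v w h p ih =>
    obtain ⟨q, hq⟩ := ih
    refine ⟨(M.path u v h).append q, fun x hx => ?_⟩
    rw [SimpleGraph.Walk.mem_support_append_iff] at hx
    right
    rcases hx with hx | hx
    · exact ⟨u, v, h, by simp, hx⟩
    · rcases hq x hx with rfl | ⟨a, b, hab, he, hx⟩
      · exact ⟨u, v, h, by simp, by simp⟩
      · exact ⟨a, b, hab, by simp [he], hx⟩

theorem branch_mem_sym2 {W V : Type*} {K : SimpleGraph W} {G : SimpleGraph V}
    (M : SubdivisionModel K G) {u v : W} (h : K.Adj u v) {w : W}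
    (hw : M.branch w ∈ (M.path u v h).support) : w ∈ s(u, v) := by
  rw [Sym2.mem_iff]
  exact M.branch_mem u v h w hw

/-- Containment of subdivisions is transitive. -/
theorem nonempty_trans {W X V : Type*} {H : SimpleGraph W} {K : SimpleGraph X} {G : SimpleGraph V}
    (M₁ : SubdivisionModel H K) (M₂ : SubdivisionModel K G) :
    Nonempty (SubdivisionModel H G) := by
  have hsup : ∀ {u v : W} (h : H.Adj u v) {a c : X}, s(a, c) ∈ (M₁.path u v h).edges →
      ∀ w ∈ s(a, c), w ∈ (M₁.path u v h).support := by
    intro u v h a c hac w hw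
    rcases Sym2.mem_iff.1 hw with rfl | rfl
    · exact SimpleGraph.Walk.fst_mem_support_of_mem_edges _ hac
    · exact SimpleGraph.Walk.snd_mem_support_of_mem_edges _ hac
  -- The inner set of an edge of H collects the `M₂`-paths along its `M₁`-path, with the composite
  -- branch vertices removed.
  refine nonempty_of_walks (M₁.branch.trans M₂.branch)
    (fun e => {x | x ∉ Set.range (M₁.branch.trans M₂.branch) ∧ ∃ u v, ∃ h : H.Adj u v, e = s(u, v) ∧
      ∃ a c, ∃ h' : K.Adj a c, s(a, c) ∈ (M₁.path u v h).edges ∧ x ∈ (M₂.path a c h').support})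
    ?_ ?_ ?_
  · intro u v h
    obtain ⟨q, hq⟩ := M₂.exists_walk_lift (M₁.path u v h)
    refine ⟨q, fun x hx => ?_⟩
    rcases hq x hx with h1 | ⟨a, c, h', he, hx'⟩
    · exact Or.inl h1
    · by_cases hr : x ∈ Set.range (M₁.branch.trans M₂.branch)
      · obtain ⟨w, rfl⟩ := hr
        have h1 := M₂.branch_mem_sym2 h' hx'
        rcases M₁.branch_mem u v h w (hsup h he _ h1) with rfl | rfl
        · exact Or.inl rfl
        · exact Or.inr (Or.inl rfl)
      · exact Or.inr (Or.inr ⟨hr, u, v, h, rfl, a, c, h', he, hx'⟩)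
  · rintro u v h w ⟨hw, -⟩
    exact hw ⟨w, rfl⟩
  · rintro u v u' v' - - hne x ⟨hx, u₁, v₁, h₁, e₁, a, c, hac, he, hxp⟩
      ⟨-, u₂, v₂, h₂, e₂, a', c', hac', he', hxp'⟩
    rw [e₁, e₂] at hne
    -- A common edge of two `M₁`-paths would have both ends in both edges of H, making these equal.
    -- If the edges of K differ, their `M₂`-paths meet only in a branch vertex, which then lies on
    -- both `M₁`-paths and so comes from H.
    by_cases hf : s(a, c) = s(a', c')
    · have hin : ∀ w ∈ s(a, c), ∃ z, M₁.branch z = w ∧ z ∈ s(u₁, v₁) ∧ z ∈ s(u₂, v₂) := by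
        intro w hw
        have hw1 := hsup h₁ he w hw
        have hw2 := hsup h₂ he' w (hf ▸ hw)
        obtain ⟨z, rfl⟩ := M₁.disjoint _ _ h₁ _ _ h₂ hne w hw1 hw2
        exact ⟨z, rfl, M₁.branch_mem_sym2 h₁ hw1, M₁.branch_mem_sym2 h₂ hw2⟩
      obtain ⟨z, rfl, hz1, hz2⟩ := hin a (by simp)
      obtain ⟨y, rfl, hy1, hy2⟩ := hin c (by simp)
      have hzy : z ≠ y := fun h => hac.ne (by rw [h])
      exact hne (((Sym2.mem_and_mem_iff hzy).1 ⟨hz1, hy1⟩).trans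
        ((Sym2.mem_and_mem_iff hzy).1 ⟨hz2, hy2⟩).symm)
    · obtain ⟨w, rfl⟩ := M₂.disjoint _ _ hac _ _ hac' hf x hxp hxp'
      have hw1 := hsup h₁ he w (M₂.branch_mem_sym2 hac hxp)
      have hw2 := hsup h₂ he' w (M₂.branch_mem_sym2 hac' hxp')
      obtain ⟨z, rfl⟩ := M₁.disjoint _ _ h₁ _ _ h₂ hne w hw1 hw2
      exact hx ⟨z, rfl⟩

end SubdivisionModel

/-! ### Models versus contained subdivisions -/

theorem SimpleGraph.Subgraph.exists_walk_map_hom_eq {V : Type*} {G : SimpleGraph V}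
    (T : G.Subgraph) {a c : V} (p : G.Walk a c) (ha : a ∈ T.verts) (hc : c ∈ T.verts)
    (hp : ∀ e ∈ p.edges, e ∈ T.edgeSet) :
    ∃ q : T.coe.Walk ⟨a, ha⟩ ⟨c, hc⟩, q.map T.hom = p := by
  induction p with
  | nil => exact ⟨.nil, rfl⟩
  | @cons u v w h p ih =>
    have huv : T.Adj u v := by simpa using hp s(u, v) (by simp)
    obtain ⟨q, hq⟩ := ih huv.snd_mem hc (fun e he => hp e (by simp [he]))
    have huv' : T.coe.Adj ⟨u, ha⟩ ⟨v, huv.snd_mem⟩ := huv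
    refine ⟨.cons huv' q, ?_⟩
    simp only [SimpleGraph.Walk.map_cons]
    congr 1

theorem SimpleGraph.Walk.mem_support_iff_of_map_eq {V V' : Type*} {G : SimpleGraph V}
    {G' : SimpleGraph V'} {f : G →g G'} {a b : V} {p : G.Walk a b} {q : G'.Walk (f a) (f b)}
    (h : p.map f = q) (y : V') : y ∈ q.support ↔ ∃ x ∈ p.support, f x = y := by
  rw [← h, SimpleGraph.Walk.support_map, List.mem_map]

theorem SimpleGraph.Walk.mem_edges_iff_of_map_eq {V V' : Type*} {G : SimpleGraph V}
    {G' : SimpleGraph V'} {f : G →g G'} {a b : V} {p : G.Walk a b} {q : G'.Walk (f a) (f b)}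
    (h : p.map f = q) (y : Sym2 V') : y ∈ q.edges ↔ ∃ x ∈ p.edges, x.map f = y := by
  rw [← h, SimpleGraph.Walk.edges_map, List.mem_map]

theorem SimpleGraph.Walk.map_eq_reverse {V V' : Type*} {G : SimpleGraph V}
    {G' : SimpleGraph V'} {f : G →g G'} (hf : Function.Injective f) {a b : V} {p : G.Walk a b}
    {p' : G.Walk b a} {q : G'.Walk (f a) (f b)} {q' : G'.Walk (f b) (f a)}
    (h : p.map f = q) (h' : p'.map f = q') (hq : q' = q.reverse) : p' = p.reverse := by
  apply SimpleGraph.Walk.map_injective_of_injective hf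
  rw [← SimpleGraph.Walk.reverse_map, h, h', hq]

/-- The union of the branch vertices and paths of a model is a subgraph that is a subdivision. From
here on only models in the ambient graph are needed. -/
theorem containsSubdivision_iff {W V : Type*} {H : SimpleGraph W} {G : SimpleGraph V} :
    ContainsSubdivision H G ↔ Nonempty (SubdivisionModel H G) := by
  constructor
  · rintro ⟨T, M, -, -⟩
    have hinj : Function.Injective T.hom := T.hom_injective
    refine ⟨⟨M.branch.trans ⟨T.hom, hinj⟩, fun u v h => (M.path u v h).map T.hom, ?_, ?_, ?_, ?_⟩⟩
    · intro u v h
      exact (M.isPath u v h).map hinj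
    · intro u v h
      refine Eq.trans (congrArg (SimpleGraph.Walk.map T.hom) (M.path_symm u v h)) ?_
      exact (SimpleGraph.Walk.reverse_map _ _).symm
    · intro u v h w hw
      obtain ⟨x, hx, hxw⟩ := (SimpleGraph.Walk.mem_support_iff_of_map_eq rfl _).1 hw
      exact M.branch_mem u v h w (hinj hxw ▸ hx)
    · intro u v h u' v' h' hne x hx hx'
      obtain ⟨y, hy, rfl⟩ := (SimpleGraph.Walk.mem_support_iff_of_map_eq rfl _).1 hx
      obtain ⟨z, hz, hzy⟩ := (SimpleGraph.Walk.mem_support_iff_of_map_eq rfl _).1 hx'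
      obtain ⟨w, rfl⟩ := M.disjoint u v h u' v' h' hne y hy (hinj hzy ▸ hz)
      exact ⟨w, rfl⟩
  · rintro ⟨M⟩
    let T : G.Subgraph :=
      { verts := {x | x ∈ Set.range M.branch ∨ ∃ u v, ∃ h : H.Adj u v, x ∈ (M.path u v h).support}
        Adj := fun x y => ∃ u v, ∃ h : H.Adj u v, s(x, y) ∈ (M.path u v h).edges
        adj_sub := by
          rintro x y ⟨u, v, h, he⟩
          exact SimpleGraph.Walk.adj_of_mem_edges _ he
        edge_vert := by
          rintro x y ⟨u, v, h, he⟩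
          exact Or.inr ⟨u, v, h, SimpleGraph.Walk.fst_mem_support_of_mem_edges _ he⟩
        symm := ⟨by
          rintro x y ⟨u, v, h, he⟩
          exact ⟨u, v, h, Sym2.eq_swap (a := x) ▸ he⟩⟩ }
    have hbr : ∀ w, M.branch w ∈ T.verts := fun w => Or.inl ⟨w, rfl⟩
    have hE : ∀ u v (h : H.Adj u v), ∀ e ∈ (M.path u v h).edges, e ∈ T.edgeSet := by
      intro u v h e he
      induction e with
      | _ x y => exact ⟨u, v, h, he⟩
    choose q hq using fun u v (h : H.Adj u v) =>
      T.exists_walk_map_hom_eq (M.path u v h) (hbr u) (hbr v) (hE u v h)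
    have hinj : Function.Injective T.hom := T.hom_injective
    have hmem : ∀ u v (h : H.Adj u v) x, x ∈ (q u v h).support →
        (x : V) ∈ (M.path u v h).support := by
      intro u v h x hx
      exact (SimpleGraph.Walk.mem_support_iff_of_map_eq (hq u v h) _).2 ⟨x, hx, rfl⟩
    refine ⟨T, ⟨⟨fun w => ⟨M.branch w, hbr w⟩, fun a b h => M.branch.injective
      (congrArg Subtype.val h)⟩, q, ?_, ?_, ?_, ?_⟩, ?_, ?_⟩
    · intro u v h
      have h1 := M.isPath u v h
      rw [← hq u v h] at h1
      exact SimpleGraph.Walk.IsPath.of_map h1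
    · intro u v h
      exact SimpleGraph.Walk.map_eq_reverse hinj (hq u v h) (hq v u h.symm) (M.path_symm u v h)
    · intro u v h w hw
      exact M.branch_mem u v h w (hmem u v h _ hw)
    · intro u v h u' v' h' hne x hx hx'
      obtain ⟨w, hw⟩ := M.disjoint u v h u' v' h' hne x (hmem _ _ _ _ hx) (hmem _ _ _ _ hx')
      exact ⟨w, Subtype.ext hw⟩
    · rintro ⟨x, hx⟩
      rcases hx with ⟨w, hw⟩ | ⟨u, v, h, hx⟩
      · exact Or.inl ⟨w, Subtype.ext hw⟩
      · refine Or.inr ⟨u, v, h, ?_⟩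
        obtain ⟨y, hy, hyx⟩ := (SimpleGraph.Walk.mem_support_iff_of_map_eq (hq u v h) _).1 hx
        exact (Subtype.ext hyx : y = ⟨x, _⟩) ▸ hy
    · intro e
      induction e with
      | _ x y =>
        rintro ⟨u, v, h, he⟩
        refine ⟨u, v, h, ?_⟩
        obtain ⟨e', he', hee⟩ := (SimpleGraph.Walk.mem_edges_iff_of_map_eq (hq u v h) _).1 he
        exact (Sym2.map.injective hinj hee : e' = s(x, y)) ▸ he'

/-! ### Linear density forces subdivisions -/

section Sparsity

open scoped Classical
open Finset

/-- The number of neighbours of `v` in `S`. -/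
noncomputable def SimpleGraph.degIn {V : Type*} (G : SimpleGraph V) (S : Finset V) (v : V) : ℕ :=
  #{w ∈ S | G.Adj v w}

/-- The number of ordered pairs of adjacent vertices of `S`. -/
noncomputable def SimpleGraph.adjPairs {V : Type*} (G : SimpleGraph V) (S : Finset V) : ℕ :=
  ∑ v ∈ S, G.degIn S v

/-- Any two vertices of `U` are joined by a walk inside `U`. -/
def SimpleGraph.ConnIn {V : Type*} (G : SimpleGraph V) (U : Finset V) : Prop :=
  ∀ a ∈ U, ∀ b ∈ U, ∃ p : G.Walk a b, ∀ x ∈ p.support, x ∈ U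

theorem SimpleGraph.degIn_insert {V : Type*} (G : SimpleGraph V) {S : Finset V} {w : V}
    (hw : w ∉ S) (v : V) :
    G.degIn (insert w S) v = G.degIn S v + if G.Adj v w then 1 else 0 := by
  unfold SimpleGraph.degIn
  rw [Finset.filter_insert]
  split_ifs with h
  · rw [Finset.card_insert_of_notMem (by simp [hw])]
  · simp

theorem SimpleGraph.adjPairs_insert {V : Type*} (G : SimpleGraph V) {S : Finset V} {w : V}
    (hw : w ∉ S) : G.adjPairs (insert w S) = G.adjPairs S + 2 * G.degIn S w := by
  unfold SimpleGraph.adjPairs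
  rw [Finset.sum_insert hw]
  simp only [G.degIn_insert hw, SimpleGraph.irrefl, if_false, add_zero, Finset.sum_add_distrib]
  have : ∑ x ∈ S, (if G.Adj x w then 1 else 0) = G.degIn S w := by
    rw [Finset.sum_boole, SimpleGraph.degIn]
    simp only [G.adj_comm, Nat.cast_id]
  rw [this]
  ring

/-- Mader's contraction argument: contract a connected set U as long as the density survives. When
this stops, contracting a further boundary vertex w loses more than 2d ordered pairs. These come
from the edge at w and from common neighbours of w and U, so w has at least d neighbours in the
boundary. -/
theorem SimpleGraph.exists_connIn_dense_boundary {V : Type*} (G : SimpleGraph V) {d : ℕ}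
    (hd : 1 ≤ d) (S : Finset V) (hS : S.Nonempty) (h : 2 * d * #S ≤ G.adjPairs S) :
    ∃ U N : Finset V, U ⊆ S ∧ N ⊆ S ∧ Disjoint U N ∧ G.ConnIn U ∧ N.Nonempty ∧
      (∀ w ∈ N, ∃ u ∈ U, G.Adj w u) ∧ d * #N ≤ G.adjPairs N := by
  induction S using Finset.strongInduction with
  | H S ih =>
  by_cases hmin : ∃ S' ⊂ S, S'.Nonempty ∧ 2 * d * #S' ≤ G.adjPairs S'
  · obtain ⟨S', hS', hne, hh⟩ := hmin
    obtain ⟨U, N, h1, h2, h3⟩ := ih S' hS' hne hh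
    exact ⟨U, N, h1.trans hS'.1, h2.trans hS'.1, h3⟩
  push Not at hmin
  let bd : Finset V → Finset V := fun U => {w ∈ S \ U | ∃ u ∈ U, G.Adj w u}
  -- With U contracted to one vertex, S has #(S \ U) + 1 vertices and adjPairs (S \ U) + 2 #(bd U)
  -- ordered adjacent pairs.
  let good : Finset V → Prop := fun U => U.Nonempty ∧ G.ConnIn U ∧
    2 * d * (#(S \ U) + 1) ≤ G.adjPairs (S \ U) + 2 * #(bd U)
  obtain ⟨v, hv⟩ := hS
  have hgood : ({v} : Finset V) ∈ S.powerset.filter good := by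
    rw [Finset.mem_filter, Finset.mem_powerset]
    refine ⟨by simpa using hv, by simp, ?_, ?_⟩
    · intro a ha b hb
      rw [Finset.mem_singleton] at ha hb
      subst ha hb
      exact ⟨.nil, by simp⟩
    · have h1 : S = insert v (S \ {v}) := by
        rw [Finset.sdiff_singleton_eq_erase, Finset.insert_erase hv]
      have h2 : v ∉ S \ {v} := by simp
      have h3 : #S = #(S \ {v}) + 1 := by
        conv_lhs => rw [h1]
        rw [Finset.card_insert_of_notMem h2]
      have h4 : G.adjPairs S = G.adjPairs (S \ {v}) + 2 * G.degIn (S \ {v}) v := by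
        conv_lhs => rw [h1]
        rw [G.adjPairs_insert h2]
      have h5 : #(bd {v}) = G.degIn (S \ {v}) v := by
        simp only [bd, SimpleGraph.degIn, Finset.mem_singleton, exists_eq_left, G.adj_comm]
      rw [h5, ← h4, ← h3]
      exact h
  obtain ⟨U, hU, hmax⟩ := Finset.exists_max_image _ Finset.card ⟨_, hgood⟩
  rw [Finset.mem_filter, Finset.mem_powerset] at hU
  obtain ⟨hUS, hUne, hUc, hUd⟩ := hU
  have hdeg : ∀ w ∈ bd U, d ≤ G.degIn (bd U) w := by
    intro w hw
    have hw' := hw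
    simp only [bd, Finset.mem_filter, Finset.mem_sdiff] at hw'
    obtain ⟨⟨hwS, hwU⟩, u, huU, hwu⟩ := hw'
    have hnot : ¬ good (insert w U) := by
      intro hg
      have := hmax (insert w U) (by
        rw [Finset.mem_filter, Finset.mem_powerset]
        exact ⟨Finset.insert_subset hwS hUS, hg⟩)
      rw [Finset.card_insert_of_notMem hwU] at this
      omega
    have hconn : G.ConnIn (insert w U) := by
      have hto : ∀ a ∈ insert w U, ∃ p : G.Walk a u, ∀ x ∈ p.support, x ∈ insert w U := by
        intro a ha
        rw [Finset.mem_insert] at ha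
        rcases ha with rfl | ha
        · exact ⟨hwu.toWalk, by simp [huU]⟩
        · obtain ⟨p, hp⟩ := hUc a ha u huU
          exact ⟨p, fun x hx => Finset.mem_insert_of_mem (hp x hx)⟩
      intro a ha b hb
      obtain ⟨p, hp⟩ := hto a ha
      obtain ⟨q, hq⟩ := hto b hb
      refine ⟨p.append q.reverse, fun x hx => ?_⟩
      rw [SimpleGraph.Walk.mem_support_append_iff, SimpleGraph.Walk.support_reverse,
        List.mem_reverse] at hx
      exact hx.elim (hp x) (hq x)
    have hlt : G.adjPairs (S \ insert w U) + 2 * #(bd (insert w U)) <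
        2 * d * (#(S \ insert w U) + 1) := by
      by_contra hcon
      exact hnot ⟨by simp, hconn, not_lt.1 hcon⟩
    set S' := S \ insert w U with hS'
    have hwS' : w ∉ S' := by simp [S']
    have hSU : S \ U = insert w S' := by
      ext z
      simp only [S', Finset.mem_sdiff, Finset.mem_insert]
      by_cases hz : z = w
      · subst hz; simp [hwS, hwU]
      · simp [hz]
    -- A and B are the other neighbours of U and those of w; A ∩ B is what the contraction of w
    -- merges. Subtracting `hlt` from `hUd` gives 2d < 2 #(A ∩ B) + 2.
    set A := {z ∈ S' | ∃ u ∈ U, G.Adj z u} with hA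
    set B := {z ∈ S' | G.Adj w z} with hB
    have hbU : bd U = insert w A := by
      simp only [bd, hSU, Finset.filter_insert, A]
      rw [if_pos ⟨u, huU, hwu⟩]
    have hwA : w ∉ A := by simp [A, hwS']
    have hbU' : bd (insert w U) = A ∪ B := by
      ext z
      simp only [bd, ← hS', A, B, Finset.mem_filter, Finset.mem_union, Finset.mem_insert,
        exists_eq_or_imp, G.adj_comm z w]
      by_cases hz : z ∈ S' <;> simp [hz, or_comm]
    have hi : G.degIn (bd U) w = #(A ∩ B) := by
      rw [hbU, G.degIn_insert hwA, if_neg (G.irrefl), add_zero, SimpleGraph.degIn]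
      congr 1
      ext z
      simp only [A, B, Finset.mem_filter, Finset.mem_inter]
      tauto
    have hcard := Finset.card_union_add_card_inter A B
    have hBd : G.degIn S' w = #B := rfl
    rw [hSU, G.adjPairs_insert hwS', Finset.card_insert_of_notMem hwS', hbU,
      Finset.card_insert_of_notMem hwA, hBd] at hUd
    rw [hbU'] at hlt
    rw [hi]
    have e1 : 2 * d * (#S' + 1 + 1) = 2 * d * (#S' + 1) + 2 * d := by ring
    omega
  refine ⟨U, bd U, hUS, fun w hw => ?_, ?_, hUc, ?_, ?_, ?_⟩
  · simp only [bd, Finset.mem_filter, Finset.mem_sdiff] at hw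
    exact hw.1.1
  · rw [Finset.disjoint_left]
    intro w hw hw'
    simp only [bd, Finset.mem_filter, Finset.mem_sdiff] at hw'
    exact hw'.1.2 hw
  -- With an empty boundary, S \ U alone would meet the density bound, against the minimality of S.
  · by_contra hne
    rw [Finset.not_nonempty_iff_eq_empty] at hne
    rw [hne, Finset.card_empty, mul_zero, add_zero] at hUd
    rcases (S \ U).eq_empty_or_nonempty with he | he
    · rw [he] at hUd
      simp [SimpleGraph.adjPairs] at hUd
      omega
    · have := hmin (S \ U) (Finset.sdiff_ssubset hUS hUne) he
      have e1 : 2 * d * (#(S \ U) + 1) = 2 * d * #(S \ U) + 2 * d := by ring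
      omega
  · intro w hw
    simp only [bd, Finset.mem_filter] at hw
    exact hw.2
  · rw [SimpleGraph.adjPairs, mul_comm, ← smul_eq_mul]
    exact Finset.card_nsmul_le_sum _ _ _ hdeg

/-- In a dense graph there are many pairwise disjoint connected sets with many common
neighbours. -/
theorem SimpleGraph.exists_disjoint_connIn {V : Type*} (G : SimpleGraph V) (M : ℕ) {d : ℕ}
    (hd : 1 ≤ d) (S : Finset V) (hS : S.Nonempty) (h : 2 ^ M * d * #S ≤ G.adjPairs S) :
    ∃ (T : Finset V) (U : ℕ → Finset V), T ⊆ S ∧ d ≤ #T ∧ (∀ i < M, U i ⊆ S) ∧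
      (∀ i < M, Disjoint (U i) T) ∧ (∀ i < M, ∀ j < M, i ≠ j → Disjoint (U i) (U j)) ∧
      (∀ i < M, G.ConnIn (U i)) ∧ ∀ i < M, ∀ t ∈ T, ∃ u ∈ U i, G.Adj t u := by
  induction M generalizing S with
  | zero =>
    refine ⟨S, fun _ => ∅, subset_rfl, ?_, by simp⟩
    have h1 : G.adjPairs S ≤ #S * #S := by
      rw [SimpleGraph.adjPairs, ← smul_eq_mul]
      exact Finset.sum_le_card_nsmul _ _ _ fun v _ => Finset.card_filter_le _ _
    rw [pow_zero, one_mul] at h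
    exact Nat.le_of_mul_le_mul_right (h.trans h1) hS.card_pos
  | succ M ih =>
    -- Each round halves the density and passes to the boundary N, so the new set is adjacent to
    -- everything that remains.
    obtain ⟨U₀, N, hU₀, hN, hdis, hconn, hne, hadj, hdense⟩ :=
      G.exists_connIn_dense_boundary (d := 2 ^ M * d)
        (Nat.mul_pos (by positivity) hd) S hS (by rw [pow_succ] at h; linarith)
    obtain ⟨T, U, hT, hdT, hUN, hUT, hUU, hUc, hUa⟩ := ih N hne hdense
    refine ⟨T, fun i => if i = M then U₀ else U i, hT.trans hN, hdT, ?_, ?_, ?_, ?_, ?_⟩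
    · intro i hi
      by_cases h1 : i = M
      · simpa [h1] using hU₀
      · simpa [h1] using (hUN i (by omega)).trans hN
    · intro i hi
      by_cases h1 : i = M
      · simpa [h1] using hdis.mono_right hT
      · simpa [h1] using hUT i (by omega)
    · intro i hi j hj hij
      by_cases h1 : i = M
      · have h2 : j ≠ M := by omega
        simpa [h1, h2] using hdis.mono_right (hUN j (by omega))
      · by_cases h2 : j = M
        · simpa [h1, h2] using (hdis.mono_right (hUN i (by omega))).symm
        · simpa [h1, h2] using hUU i (by omega) j (by omega) hij
    · intro i hi
      by_cases h1 : i = M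
      · simpa [h1] using hconn
      · simpa [h1] using hUc i (by omega)
    · intro i hi t ht
      by_cases h1 : i = M
      · simpa [h1] using hadj t (hT ht)
      · simpa [h1] using hUa i (by omega) t ht

/-- A graph with at least linearly many edges (with a constant depending on `H`) contains a
subdivision of `H`. -/
theorem SubdivisionModel.nonempty_of_dense {W V : Type*} [Fintype W] (H : SimpleGraph W)
    (G : SimpleGraph V) (S : Finset V) (hS : S.Nonempty)
    (h : 2 ^ Fintype.card (Sym2 W) * (Fintype.card W + 1) * #S ≤ G.adjPairs S) :
    Nonempty (SubdivisionModel H G) := by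
  obtain ⟨T, U, -, hT, -, hUT, hUU, hUc, hUa⟩ :=
    G.exists_disjoint_connIn (Fintype.card (Sym2 W)) (by omega) S hS h
  obtain ⟨b⟩ : Nonempty (W ↪ T) := by
    rw [Function.Embedding.nonempty_iff_card_le, Fintype.card_coe]
    omega
  let c := Fintype.equivFin (Sym2 W)
  -- Branch vertices lie in T, and each edge of H is routed through its own connected set.
  refine nonempty_of_walks (b.trans (Function.Embedding.subtype _))
    (fun e => (U (c e) : Set V)) ?_ ?_ ?_
  · intro u v _
    obtain ⟨u', hu', huu⟩ := hUa (c s(u, v)) (c s(u, v)).2 (b u) (b u).2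
    obtain ⟨v', hv', hvv⟩ := hUa (c s(u, v)) (c s(u, v)).2 (b v) (b v).2
    obtain ⟨p, hp⟩ := hUc (c s(u, v)) (c s(u, v)).2 u' hu' v' hv'
    refine ⟨.cons huu (p.append hvv.symm.toWalk), fun x hx => ?_⟩
    replace hx : x ∈ (SimpleGraph.Walk.cons huu (p.append hvv.symm.toWalk)).support := hx
    simp only [SimpleGraph.Walk.support_cons, List.mem_cons,
      SimpleGraph.Walk.mem_support_append_iff] at hx
    rcases hx with rfl | hx | hx
    · exact Or.inl rfl
    · exact Or.inr (Or.inr (hp x hx))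
    · simp at hx
      rcases hx with rfl | rfl
      · exact Or.inr (Or.inr hv')
      · exact Or.inr (Or.inl rfl)
  · intro u v _ w hw
    exact Finset.disjoint_left.1 (hUT _ (c s(u, v)).2) hw (b w).2
  · intro u v u' v' _ _ hne x hx hx'
    refine Finset.disjoint_left.1 (hUU _ (c s(u, v)).2 _ (c s(u', v')).2 ?_) hx hx'
    intro h1
    exact hne (c.injective (Fin.ext h1))

end Sparsity

/-! ### Perron eigenvectors of graphs -/

section Spectral

open scoped Classical
open Finset Matrix
open scoped Pointwise

theorem adjMatrix_mulVec_eq {V : Type*} [Fintype V] (G : SimpleGraph V) (x : V → ℝ) (v : V) :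
    (G.adjMatrix ℝ *ᵥ x) v = ∑ u with G.Adj v u, x u := by
  rw [SimpleGraph.adjMatrix_mulVec_apply]
  congr 1
  ext u
  simp

theorem ofReal_le_graphSpectralRadius {V : Type*} [Fintype V] (G : SimpleGraph V) {y : V → ℝ}
    (hy : y ≠ 0) {r : ℝ} (h : ∀ v, ∑ u with G.Adj v u, y u = r * y v) :
    ENNReal.ofReal r ≤ graphSpectralRadius G := by
  have hmem : r ∈ spectrum ℝ (G.adjMatrix ℝ) := by
    rw [← Matrix.spectrum_toLin', ← Module.End.hasEigenvalue_iff_mem_spectrum]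
    refine Module.End.hasEigenvalue_of_hasEigenvector (x := y) ⟨?_, hy⟩
    rw [Module.End.mem_eigenspace_iff]
    ext v
    rw [Matrix.toLin'_apply, adjMatrix_mulVec_eq, h v]
    rfl
  calc ENNReal.ofReal r ≤ (‖r‖₊ : ENNReal) := by
        rw [← enorm_eq_nnnorm, ← ofReal_norm]
        exact ENNReal.ofReal_le_ofReal (le_abs_self r)
    _ ≤ _ := le_iSup₂ (f := fun (k : ℝ) (_ : k ∈ spectrum ℝ (G.adjMatrix ℝ)) =>
        (‖k‖₊ : ENNReal)) r hmem

/-- The spectral radius of a graph is an eigenvalue with a nonnegative eigenvector. -/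
theorem exists_nonneg_eigenvector {V : Type*} [Fintype V] [Nonempty V] (G : SimpleGraph V) :
    ∃ (ρ : ℝ) (x : V → ℝ), 0 ≤ ρ ∧ graphSpectralRadius G = ENNReal.ofReal ρ ∧ (∀ v, 0 ≤ x v) ∧
      x ≠ 0 ∧ ∀ v, ∑ u with G.Adj v u, x u = ρ * x v := by
  set A := G.adjMatrix ℝ with hA
  have hherm : A.IsHermitian := by
    rw [Matrix.IsHermitian, Matrix.conjTranspose_eq_transpose_of_trivial]
    exact G.isSymm_adjMatrix
  have hfin : (spectrum ℝ A).Finite := Matrix.finite_real_spectrum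
  have hne : (spectrum ℝ A).Nonempty :=
    ⟨_, hherm.eigenvalues_mem_spectrum_real (Classical.arbitrary V)⟩
  obtain ⟨l, hl, hmax⟩ := Set.exists_max_image (spectrum ℝ A) (fun k => |k|) hfin hne
  have hrad : graphSpectralRadius G = ENNReal.ofReal |l| := by
    apply le_antisymm
    · refine iSup₂_le fun k hk => ?_
      rw [← enorm_eq_nnnorm, ← ofReal_norm]
      exact ENNReal.ofReal_le_ofReal (hmax k hk)
    · rw [← Real.norm_eq_abs, ofReal_norm, enorm_eq_nnnorm]
      exact le_iSup₂ (f := fun (k : ℝ) (_ : k ∈ spectrum ℝ A) => (‖k‖₊ : ENNReal)) l hl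
  obtain ⟨z, hz, hz0⟩ : ∃ z : V → ℝ, A *ᵥ z = l • z ∧ z ≠ 0 := by
    rw [← Matrix.spectrum_toLin', ← Module.End.hasEigenvalue_iff_mem_spectrum] at hl
    obtain ⟨z, hz⟩ := hl.exists_hasEigenvector
    exact ⟨z, by simpa using hz.apply_eq_smul, hz.2⟩
  -- No eigenvalue exceeds |l|, so |l| - A is positive semidefinite. Its quadratic form is
  -- nonpositive at |z| by the triangle inequality, hence zero there, so |z| lies in its kernel.
  set B : Matrix V V ℝ := algebraMap ℝ _ |l| - A with hB
  have hBh : B.IsHermitian := by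
    refine Matrix.IsHermitian.sub ?_ hherm
    rw [Algebra.algebraMap_eq_smul_one, Matrix.IsHermitian, Matrix.conjTranspose_smul]
    simp
  have hpsd : B.PosSemidef := by
    rw [hBh.posSemidef_iff_eigenvalues_nonneg]
    intro i
    have h1 : hBh.eigenvalues i ∈ ({|l|} : Set ℝ) - spectrum ℝ A := by
      rw [spectrum.singleton_sub_eq]
      exact hBh.eigenvalues_mem_spectrum_real i
    obtain ⟨a, ha, k, hk, hak⟩ := Set.mem_sub.1 h1
    have h2 := hmax k hk
    have h3 := le_abs_self k
    simp only [Set.mem_singleton_iff] at ha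
    simp only [Pi.zero_apply]
    rw [← hak]
    linarith
  let x : V → ℝ := fun v => |z v|
  have hBx : ∀ w : V → ℝ, B *ᵥ w = |l| • w - A *ᵥ w := by
    intro w
    rw [hB, Matrix.sub_mulVec, Algebra.algebraMap_eq_smul_one, Matrix.smul_mulVec,
      Matrix.one_mulVec]
  have hzero : star x ⬝ᵥ B *ᵥ x = 0 := by
    apply le_antisymm
    · have h1 : ∀ v, |l| * x v ≤ (A *ᵥ x) v := by
        intro v
        have h2 : (A *ᵥ z) v = l * z v := by rw [hz]; rfl
        rw [hA, adjMatrix_mulVec_eq] at h2 ⊢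
        rw [← abs_mul, ← h2]
        exact Finset.abs_sum_le_sum_abs _ _
      rw [hBx, star_trivial, dotProduct]
      refine Finset.sum_nonpos fun v _ => ?_
      have h3 := h1 v
      have h4 : 0 ≤ x v := abs_nonneg _
      have h5 : (|l| • x - A *ᵥ x) v = |l| * x v - (A *ᵥ x) v := rfl
      rw [h5]
      exact mul_nonpos_of_nonneg_of_nonpos h4 (by linarith)
    · exact hpsd.dotProduct_mulVec_nonneg x
  rw [hpsd.dotProduct_mulVec_zero_iff, hBx, sub_eq_zero] at hzero
  refine ⟨|l|, x, abs_nonneg _, hrad, fun v => abs_nonneg _, ?_, ?_⟩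
  · intro h0
    apply hz0
    ext v
    have := congrFun h0 v
    simpa [x] using this
  · intro v
    rw [← adjMatrix_mulVec_eq]
    exact (congrFun hzero v).symm

theorem graphSpectralRadius_le_of_iso {V V' : Type*} [Fintype V] [Fintype V'] [Nonempty V]
    {G : SimpleGraph V} {G' : SimpleGraph V'} (e : G ≃g G') :
    graphSpectralRadius G ≤ graphSpectralRadius G' := by
  obtain ⟨ρ, x, -, hρ, -, hx0, hx⟩ := exists_nonneg_eigenvector G
  rw [hρ]
  refine ofReal_le_graphSpectralRadius G' (y := fun v => x (e.symm v)) ?_ ?_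
  · intro h0
    apply hx0
    ext v
    simpa using congrFun h0 (e v)
  · intro v
    rw [← hx (e.symm v)]
    refine Finset.sum_equiv e.symm.toEquiv ?_ ?_
    · intro u
      simp only [Finset.mem_filter, Finset.mem_univ, true_and]
      exact e.symm.map_adj_iff.symm
    · intro u _
      rfl

theorem graphSpectralRadius_eq_of_iso {V V' : Type*} [Fintype V] [Fintype V'] [Nonempty V]
    {G : SimpleGraph V} {G' : SimpleGraph V'} (e : G ≃g G') :
    graphSpectralRadius G = graphSpectralRadius G' := by
  have : Nonempty V' := ⟨e (Classical.arbitrary V)⟩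
  exact le_antisymm (graphSpectralRadius_le_of_iso e) (graphSpectralRadius_le_of_iso e.symm)

end Spectral

/-! ### Locating the spine by eigenvector weights -/

section Core

open scoped Classical
open Finset

theorem card_filter_lt_mul_le {V : Type*} [Fintype V] (G : SimpleGraph V) {ρ η D : ℝ}
    {x : V → ℝ} (hsp : (G.adjPairs univ : ℝ) ≤ D * Fintype.card V) (hρ : 0 ≤ ρ)
    (hx0 : ∀ v, 0 ≤ x v) (hx1 : ∀ v, x v ≤ 1) (hx : ∀ v, ∑ u with G.Adj v u, x u = ρ * x v) :
    (#{v | η < x v} : ℝ) * (η * ρ) ≤ D * Fintype.card V := by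
  calc (#{v | η < x v} : ℝ) * (η * ρ) = ∑ v with η < x v, η * ρ := by
        rw [Finset.sum_const, nsmul_eq_mul]
    _ ≤ ∑ v with η < x v, ρ * x v := by
        refine Finset.sum_le_sum fun v hv => ?_
        rw [mul_comm]
        exact mul_le_mul_of_nonneg_left (Finset.mem_filter.1 hv).2.le hρ
    _ ≤ ∑ v, ρ * x v := Finset.sum_le_sum_of_subset_of_nonneg (Finset.filter_subset _ _)
        fun v _ _ => mul_nonneg hρ (hx0 v)
    _ ≤ ∑ v, (G.degIn univ v : ℝ) := by
        refine Finset.sum_le_sum fun v _ => ?_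
        rw [← hx v, SimpleGraph.degIn, ← nsmul_one]
        exact Finset.sum_le_card_nsmul _ _ _ fun u _ => hx1 u
    _ = (G.adjPairs univ : ℝ) := by rw [SimpleGraph.adjPairs]; push_cast; rfl
    _ ≤ _ := hsp

/-- Expand A²x at v as a sum over walks of length two. Those ending at a vertex of weight at most η
contribute at most η times the degree sum. -/
theorem sq_mul_le_sum_sum_large {V : Type*} [Fintype V] (G : SimpleGraph V) {ρ η D : ℝ}
    {x : V → ℝ} (hsp : (G.adjPairs univ : ℝ) ≤ D * Fintype.card V) (hη : 0 ≤ η)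
    (hx : ∀ v, ∑ u with G.Adj v u, x u = ρ * x v) (v : V) :
    ρ ^ 2 * x v ≤ η * (D * Fintype.card V) +
      ∑ u with G.Adj v u, ∑ w ∈ {w | η < x w} with G.Adj u w, x w := by
  have h1 : ρ ^ 2 * x v = ∑ u with G.Adj v u, ∑ w with G.Adj u w, x w := by
    rw [pow_two, mul_assoc, ← hx v, Finset.mul_sum]
    exact Finset.sum_congr rfl fun u _ => (hx u).symm
  have h2 : ∀ u, ∑ w with G.Adj u w, x w ≤ η * G.degIn univ u +
      ∑ w ∈ {w | η < x w} with G.Adj u w, x w := by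
    intro u
    rw [← Finset.sum_filter_add_sum_filter_not ({w | G.Adj u w} : Finset V) (fun w => η < x w),
      add_comm]
    refine add_le_add ?_ (le_of_eq ?_)
    · calc _ ≤ ∑ w ∈ {w | G.Adj u w} with ¬ η < x w, η :=
            Finset.sum_le_sum fun w hw => not_lt.1 (Finset.mem_filter.1 hw).2
        _ ≤ ∑ w with G.Adj u w, η := Finset.sum_le_sum_of_subset_of_nonneg
            (Finset.filter_subset _ _) fun _ _ _ => hη
        _ = _ := by rw [Finset.sum_const, nsmul_eq_mul, mul_comm, SimpleGraph.degIn]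
    · rw [Finset.filter_comm]
  rw [h1]
  calc _ ≤ ∑ u with G.Adj v u, (η * G.degIn univ u +
        ∑ w ∈ {w | η < x w} with G.Adj u w, x w) := Finset.sum_le_sum fun u _ => h2 u
    _ = η * ∑ u with G.Adj v u, (G.degIn univ u : ℝ) +
        ∑ u with G.Adj v u, ∑ w ∈ {w | η < x w} with G.Adj u w, x w := by
        rw [Finset.sum_add_distrib, Finset.mul_sum]
    _ ≤ _ := by
        gcongr
        refine le_trans ?_ hsp
        rw [SimpleGraph.adjPairs]
        push_cast
        exact Finset.sum_le_sum_of_subset_of_nonneg (Finset.filter_subset _ _)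
          fun _ _ _ => Nat.cast_nonneg _

theorem sum_degIn_le_adjPairs_union {V : Type*} (G : SimpleGraph V) (A B : Finset V) :
    ∑ u ∈ A, G.degIn B u ≤ G.adjPairs (A ∪ B) := by
  calc ∑ u ∈ A, G.degIn B u ≤ ∑ u ∈ A, G.degIn (A ∪ B) u :=
        Finset.sum_le_sum fun u _ => Finset.card_le_card
          (Finset.filter_subset_filter _ Finset.subset_union_right)
    _ ≤ _ := Finset.sum_le_sum_of_subset Finset.subset_union_left

/-- Every vertex counted is a common neighbour of some (s+1)-subset of L, and L has at most 2^#L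
such subsets. -/
theorem card_filter_lt_degIn_le {V : Type*} [Fintype V] (G : SimpleGraph V) {s t : ℕ}
    (hK : ∀ A : Finset V, #A = s + 1 → #{v | ∀ a ∈ A, G.Adj a v} < t) (L : Finset V) :
    #{u | s < G.degIn L u} ≤ 2 ^ #L * t := by
  have hsub : ({u | s < G.degIn L u} : Finset V) ⊆
      (L.powersetCard (s + 1)).biUnion fun A => {v | ∀ a ∈ A, G.Adj a v} := by
    intro u hu
    have hu' : s + 1 ≤ #{w ∈ L | G.Adj u w} := (Finset.mem_filter.1 hu).2
    obtain ⟨A, hA, hAc⟩ := Finset.exists_subset_card_eq hu'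
    rw [Finset.mem_biUnion]
    refine ⟨A, Finset.mem_powersetCard.2 ⟨hA.trans (Finset.filter_subset _ _), hAc⟩, ?_⟩
    simp only [Finset.mem_filter, Finset.mem_univ, true_and]
    intro a ha
    exact (Finset.mem_filter.1 (hA ha)).2.symm
  refine (Finset.card_le_card hsub).trans ?_
  refine (Finset.card_biUnion_le_card_mul _ _ t ?_).trans ?_
  · intro A hA
    exact (hK A (Finset.mem_powersetCard.1 hA).2).le
  · refine Nat.mul_le_mul_right _ ?_
    rw [← Finset.card_powerset]
    exact Finset.card_le_card (fun A hA => Finset.mem_powerset.2 (Finset.mem_powersetCard.1 hA).1)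

set_option maxHeartbeats 1000000 in
-- By sparsity, vertices of weight above η have linear degree, so there are boundedly many. All but
-- boundedly many vertices see at most γ of them. As ρ² is about γn, the equation for A²x at a
-- vertex of weight 1 is nearly tight, so some vertex sees exactly γ heavy vertices, all of weight
-- near 1. These form L.
theorem exists_dominating_set {γ D t : ℕ} (hγ : 1 ≤ γ) (hD : 1 ≤ D) {ε : ℝ} (hε : 0 < ε)
    (hε1 : ε ≤ 1) :
    ∃ N : ℕ, ∀ n : ℕ, N ≤ n → ∀ (V : Type) [Fintype V], Fintype.card V = n →
      ∀ (G : SimpleGraph V) (ρ : ℝ) (x : V → ℝ),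
      (∀ S, G.adjPairs S ≤ D * #S) →
      (∀ A : Finset V, #A = γ + 1 → #{v | ∀ a ∈ A, G.Adj a v} < t) →
      0 ≤ ρ → γ * (n - γ : ℝ) ≤ ρ ^ 2 → (∀ v, 0 ≤ x v) → (∀ v, x v ≤ 1) → (∃ v, x v = 1) →
      (∀ v, ∑ u with G.Adj v u, x u = ρ * x v) →
      ∃ L : Finset V, #L = γ ∧ (∀ l ∈ L, 1 / 2 ≤ x l) ∧ (∀ v ∉ L, x v ≤ ε) ∧
        (n / 2 : ℝ) ≤ #{v | ∀ l ∈ L, G.Adj l v} := by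
  have hγ' : (1 : ℝ) ≤ γ := by exact_mod_cast hγ
  have hD' : (1 : ℝ) ≤ D := by exact_mod_cast hD
  -- Here a = ηD = ε/(20γ) measures the error from light vertices, M will bound the number of
  -- vertices heavier than η, and T the contribution of vertices seeing more than γ of those. The
  -- finer threshold η' satisfies η'D = η/8, which leaves room in the degree bound.
  set η : ℝ := ε / (20 * γ * D) with hη
  have hη0 : 0 < η := by positivity
  set a : ℝ := η * D with ha
  have ha0 : 0 < a := by positivity
  have haε : 20 * γ * a = ε := by rw [ha, hη]; field_simp
  have haγ : a ≤ γ * a := le_mul_of_one_le_left ha0.le hγ'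
  have ha1 : 20 * a ≤ 1 := by linarith only [haγ, haε, hε1]
  set η' : ℝ := η / (8 * D) with hη'
  have hη'0 : 0 < η' := by positivity
  set M : ℕ := ⌈4 * (D : ℝ) ^ 2 / η⌉₊ with hM
  set T : ℕ := 2 ^ M * t * M with hT
  refine ⟨⌈2 * (D / η' ^ 2) ^ 2 + T / a + γ ^ 2 / a + 2 * t / ε + 2 * γ + 1⌉₊, ?_⟩
  intro n hn V _ hV G ρ x hsp hK hρ hρ2 hx0 hx1 hxm hx
  rw [Nat.ceil_le] at hn
  have q1 : 0 ≤ 2 * (D / η' ^ 2) ^ 2 := by positivity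
  have q2 : 0 ≤ T / a := by positivity
  have q3 : 0 ≤ (γ : ℝ) ^ 2 / a := by positivity
  have q4 : 0 ≤ 2 * t / ε := by positivity
  have n1 : (D / η' ^ 2) ^ 2 ≤ n / 2 := by linarith
  have n2 : (T : ℝ) ≤ a * n := by
    rw [← div_le_iff₀' ha0]; linarith
  have n3 : (γ : ℝ) ^ 2 < a * n := by
    rw [← div_lt_iff₀' ha0]; linarith
  have n4 : (t : ℝ) ≤ ε * n / 2 := by
    have : 2 * t / ε ≤ n := by linarith
    rw [div_le_iff₀' hε] at this
    linarith
  have n5 : 2 * (γ : ℝ) ≤ n := by linarith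
  have n6 : (γ : ℝ) < a * n := lt_of_le_of_lt (by nlinarith only [hγ']) n3
  have hn0 : (0 : ℝ) < n := by linarith
  clear hn q1 q2 q3 q4
  have hρn : (n : ℝ) / 2 ≤ ρ ^ 2 := by nlinarith only [hρ2, n5, hγ']
  have hspu : (G.adjPairs univ : ℝ) ≤ D * Fintype.card V := by
    have := hsp univ
    rw [Finset.card_univ] at this
    exact_mod_cast this
  -- few vertices have a weight that is not tiny
  have hL' : (#{v | η' < x v} : ℝ) ≤ η' * n := by
    have h1 := card_filter_lt_mul_le G (η := η') hspu hρ hx0 hx1 hx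
    rw [hV] at h1
    have h2 : D / η' ^ 2 ≤ ρ := by
      refine le_of_sq_le_sq ?_ hρ
      linarith
    have h3 : (#{v | η' < x v} : ℝ) * (η' * (D / η' ^ 2)) ≤ D * n :=
      le_trans (by gcongr) h1
    have h4 : (#{v | η' < x v} : ℝ) * (η' * (D / η' ^ 2)) =
        D * ((#{v | η' < x v} : ℝ) / η') := by field_simp
    rw [h4] at h3
    have h5 := le_of_mul_le_mul_left h3 (by linarith)
    rwa [div_le_iff₀' hη'0] at h5
  set L : Finset V := {v | η < x v} with hL
  have hs_le : ∀ (B : Finset V) (u), ∑ w ∈ B with G.Adj u w, x w ≤ G.degIn B u := by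
    intro B u
    rw [SimpleGraph.degIn, ← nsmul_one]
    exact Finset.sum_le_card_nsmul _ _ _ fun u _ => hx1 u
  -- Apply the two-step bound at threshold η' and count the last edges by sparsity of N(v) together
  -- with the at most η'n vertices above η'. Two errors ηn/8 are subtracted from ηn/2.
  have hdegL : ∀ v ∈ L, η * n / (4 * D) ≤ G.degIn univ v := by
    intro v hv
    have hv' : η < x v := (Finset.mem_filter.1 hv).2
    have h1 := sq_mul_le_sum_sum_large G hspu hη'0.le hx v
    have h2 : ∑ u with G.Adj v u, ∑ w ∈ {w | η' < x w} with G.Adj u w, x w ≤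
        D * (G.degIn univ v + #{w | η' < x w}) := by
      calc _ ≤ ∑ u with G.Adj v u, (G.degIn {w | η' < x w} u : ℝ) :=
            Finset.sum_le_sum fun u _ => hs_le _ u
        _ ≤ (G.adjPairs (({u | G.Adj v u} : Finset V) ∪ ({w | η' < x w} : Finset V)) : ℝ) := by
            exact_mod_cast sum_degIn_le_adjPairs_union G {u | G.Adj v u} {w | η' < x w}
        _ ≤ D * #(({u | G.Adj v u} : Finset V) ∪ ({w | η' < x w} : Finset V)) := by
            exact_mod_cast hsp _
        _ ≤ _ := by
            gcongr
            exact_mod_cast Finset.card_union_le _ _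
    rw [hV] at h1
    have h3 : n / 2 * η ≤ ρ ^ 2 * x v := by gcongr
    have h4 : (D : ℝ) * (G.degIn univ v + #{w | η' < x w}) ≤ D * (G.degIn univ v + η' * n) := by
      gcongr
    have h5 : η' * (D * n) = η * n / 8 := by rw [hη']; field_simp
    rw [div_le_iff₀' (by positivity)]
    linarith only [h1, h2, h3, h4, h5]
  have hLM : #L ≤ M := by
    have h1 : (#L : ℝ) * (η * n / (4 * D)) ≤ D * n := by
      calc (#L : ℝ) * (η * n / (4 * D)) = ∑ v ∈ L, η * n / (4 * D) := by
            rw [Finset.sum_const, nsmul_eq_mul]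
        _ ≤ ∑ v ∈ L, (G.degIn univ v : ℝ) := Finset.sum_le_sum hdegL
        _ ≤ ∑ v, (G.degIn univ v : ℝ) := Finset.sum_le_sum_of_subset_of_nonneg
            (Finset.subset_univ _) fun _ _ _ => Nat.cast_nonneg _
        _ = (G.adjPairs univ : ℝ) := by rw [SimpleGraph.adjPairs]; push_cast; rfl
        _ ≤ _ := by rwa [hV] at hspu
    have h2 : (#L : ℝ) ≤ 4 * (D : ℝ) ^ 2 / η := by
      rw [le_div_iff₀ hη0]
      have h3 : (#L : ℝ) * (η * n / (4 * D)) = (#L * η) * (n / (4 * D)) := by ring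
      have h4 : (D : ℝ) * n = 4 * D ^ 2 * (n / (4 * D)) := by field_simp
      rw [h3, h4] at h1
      exact le_of_mul_le_mul_right h1 (by positivity)
    exact Nat.cast_le.1 (h2.trans (Nat.le_ceil _))
  set bad : Finset V := {u | γ < G.degIn L u} with hbad
  have hbadc : (#bad : ℝ) * #L ≤ T := by
    have h1 : #bad ≤ 2 ^ M * t := (card_filter_lt_degIn_le G hK L).trans
      (Nat.mul_le_mul_right _ (Nat.pow_le_pow_right (by norm_num) hLM))
    exact_mod_cast Nat.mul_le_mul h1 hLM
  have hkey : ∀ v, ρ ^ 2 * x v ≤ 2 * a * n +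
      ∑ u ∈ {u | G.Adj v u} with u ∉ bad, ∑ w ∈ L with G.Adj u w, x w := by
    intro v
    have h1 := sq_mul_le_sum_sum_large G hspu hη0.le hx v
    rw [← Finset.sum_filter_add_sum_filter_not ({u | G.Adj v u} : Finset V) (· ∈ bad),
      hV] at h1
    have h2 : ∑ u ∈ {u | G.Adj v u} with u ∈ bad, ∑ w ∈ L with G.Adj u w, x w ≤ T := by
      calc _ ≤ ∑ u ∈ {u | G.Adj v u} with u ∈ bad, (#L : ℝ) :=
            Finset.sum_le_sum fun u _ => (hs_le L u).trans
              (by exact_mod_cast Finset.card_filter_le _ _)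
        _ ≤ ∑ u ∈ bad, (#L : ℝ) := Finset.sum_le_sum_of_subset_of_nonneg
            (fun u hu => (Finset.mem_filter.1 hu).2) fun _ _ _ => Nat.cast_nonneg _
        _ ≤ T := by rwa [Finset.sum_const, nsmul_eq_mul]
    have h3 : η * (D * n) = a * n := by rw [ha]; ring
    linarith only [h1, h2, h3, n2]
  have hgood : ∀ u ∉ bad, G.degIn L u ≤ γ := by
    intro u hu
    simpa [hbad] using hu
  have hdeg : ∀ v, ρ ^ 2 * x v ≤ 2 * a * n + γ * G.degIn univ v := by
    intro v
    refine (hkey v).trans ?_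
    gcongr
    calc _ ≤ ∑ u ∈ {u | G.Adj v u} with u ∉ bad, (γ : ℝ) :=
          Finset.sum_le_sum fun u hu => (hs_le L u).trans
            (by exact_mod_cast hgood u (Finset.mem_filter.1 hu).2)
      _ ≤ ∑ u with G.Adj v u, (γ : ℝ) := Finset.sum_le_sum_of_subset_of_nonneg
            (Finset.filter_subset _ _) fun _ _ _ => Nat.cast_nonneg _
      _ = _ := by rw [Finset.sum_const, nsmul_eq_mul, mul_comm]; rfl
  -- a vertex whose neighbours in `L` have large total weight
  obtain ⟨u, hub, hus⟩ : ∃ u ∉ bad, γ - 3 * a < ∑ w ∈ L with G.Adj u w, x w := by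
    by_contra! hcon
    obtain ⟨v, hv⟩ := hxm
    have h1 := hkey v
    have h0 : 0 ≤ γ - 3 * a := by linarith only [ha1, hγ', ha0]
    have h2 : ∑ u ∈ {u | G.Adj v u} with u ∉ bad, ∑ w ∈ L with G.Adj u w, x w ≤
        n * (γ - 3 * a) := by
      calc _ ≤ ∑ u ∈ {u | G.Adj v u} with u ∉ bad, ((γ : ℝ) - 3 * a) :=
            Finset.sum_le_sum fun u hu => hcon u (Finset.mem_filter.1 hu).2
        _ ≤ ∑ u : V, ((γ : ℝ) - 3 * a) := Finset.sum_le_sum_of_subset_of_nonneg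
            (Finset.subset_univ _) fun _ _ _ => h0
        _ = _ := by rw [Finset.sum_const, nsmul_eq_mul, Finset.card_univ, hV]
    rw [hv, mul_one] at h1
    -- The assumption gives ρ² ≤ γn - an, whereas ρ² ≥ γn - γ² and γ² < an.
    linarith only [h1, h2, hρ2, n3]
  set L₀ : Finset V := {w ∈ L | G.Adj u w} with hL₀
  have hL₀c : #L₀ = γ := by
    refine le_antisymm (hgood u hub) ?_
    have h1 := hus.trans_le (hs_le L u)
    have h2 : (γ : ℝ) - 1 < #L₀ := by
      refine lt_of_le_of_lt ?_ h1
      linarith only [ha1, ha0]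
    have h3 : (γ : ℝ) < (#L₀ + 1 : ℕ) := by push_cast; linarith
    have h4 : γ < #L₀ + 1 := by exact_mod_cast h3
    omega
  have hxL₀ : ∀ l ∈ L₀, 1 - 3 * a ≤ x l := by
    intro l hl
    have h1 : ∑ w ∈ L₀.erase l, x w ≤ (γ : ℝ) - 1 := by
      have h2 : ∑ w ∈ L₀.erase l, x w ≤ #(L₀.erase l) • (1 : ℝ) :=
        Finset.sum_le_card_nsmul _ _ _ fun u _ => hx1 u
      rw [Finset.card_erase_of_mem hl, hL₀c, nsmul_one, Nat.cast_sub hγ] at h2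
      simpa using h2
    have h3 := Finset.sum_erase_add L₀ x hl
    linarith only [h1, h3, hus]
  have hdegL₀ : ∀ l ∈ L₀, (1 - 6 * a) * n ≤ G.degIn univ l := by
    intro l hl
    have h1 := hdeg l
    have h2 := hxL₀ l hl
    have h3 : γ * (n - γ : ℝ) * (1 - 3 * a) ≤ ρ ^ 2 * x l := by
      apply mul_le_mul hρ2 h2 (by linarith only [ha1, ha0]) (by positivity)
    have h4 : (2 : ℝ) * a * n ≤ γ * (2 * a * n) := le_mul_of_one_le_left (by positivity) hγ'
    have h5 : γ * ((n - γ : ℝ) * (1 - 3 * a)) ≤ γ * (2 * a * n + G.degIn univ l) := by linarith only [h1, h3, h4]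
    have h6 := le_of_mul_le_mul_left h5 (by linarith only [hγ'])
    linarith only [h6, n6, mul_pos ha0 (zero_lt_one.trans_le hγ')]
  set W : Finset V := {v | ∀ l ∈ L₀, G.Adj l v} with hW
  have hWc : (n : ℝ) - 6 * γ * a * n ≤ #W := by
    have h1 : Wᶜ ⊆ L₀.biUnion fun l => {v | ¬ G.Adj l v} := by
      intro v hv
      rw [Finset.mem_compl, hW] at hv
      simpa using hv
    have h2 : (#Wᶜ : ℝ) ≤ γ * (6 * a * n) := by
      calc (#Wᶜ : ℝ) ≤ #(L₀.biUnion fun l => ({v | ¬ G.Adj l v} : Finset V)) := by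
            exact_mod_cast Finset.card_le_card h1
        _ ≤ ∑ l ∈ L₀, (#{v | ¬ G.Adj l v} : ℝ) := by exact_mod_cast Finset.card_biUnion_le
        _ ≤ ∑ l ∈ L₀, 6 * a * n := by
            refine Finset.sum_le_sum fun l hl => ?_
            have h3 := hdegL₀ l hl
            have h4 := Finset.card_filter_add_card_filter_not (s := (univ : Finset V))
              (fun v => G.Adj l v)
            rw [Finset.card_univ, hV] at h4
            have h5 : (G.degIn univ l : ℝ) + #{v | ¬ G.Adj l v} = n := by exact_mod_cast h4
            linarith
        _ = _ := by rw [Finset.sum_const, nsmul_eq_mul, hL₀c]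
    have h3 := Finset.card_add_card_compl W
    rw [hV] at h3
    have h4 : (#W : ℝ) + #Wᶜ = n := by exact_mod_cast h3
    linarith
  have haεn : 20 * γ * a * n = ε * n := by rw [haε]
  refine ⟨L₀, hL₀c, fun l hl => ?_, fun v hv => ?_, ?_⟩
  · have := hxL₀ l hl
    linarith
  -- A further vertex of weight above ε has degree at least (ε - 3a)n. It would therefore share more
  -- than εn/2 ≥ t neighbours with L, as W misses at most 6γan vertices.
  · by_contra! hcon
    have h1 := hdeg v
    have h3 : γ * (n - γ : ℝ) * ε ≤ ρ ^ 2 * x v := by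
      apply mul_le_mul hρ2 hcon.le hε.le (by positivity)
    have h4 : (2 : ℝ) * a * n ≤ γ * (2 * a * n) := le_mul_of_one_le_left (by positivity) hγ'
    have h5 : γ * ((n - γ : ℝ) * ε) ≤ γ * (2 * a * n + G.degIn univ v) := by linarith only [h1, h3, h4]
    have h6 := le_of_mul_le_mul_left h5 (by linarith only [hγ'])
    have h45 : γ * ε ≤ γ := mul_le_of_le_one_right (by positivity) hε1
    have h7 : ε * n - 3 * a * n ≤ G.degIn univ v := by linarith only [h6, n6, h45]
    have h8 := hK (insert v L₀) (by rw [Finset.card_insert_of_notMem hv, hL₀c])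
    have h9 : ({z | ∀ b ∈ insert v L₀, G.Adj b z} : Finset V) =
        ({z | G.Adj v z} : Finset V) ∩ W := by
      ext z
      simp [hW]
    rw [h9] at h8
    have h10 := Finset.card_union_add_card_inter ({z | G.Adj v z} : Finset V) W
    have h11 : #(({z | G.Adj v z} : Finset V) ∪ W) ≤ n := by
      simpa [hV] using Finset.card_le_univ (({z | G.Adj v z} : Finset V) ∪ W)
    have h12 : (G.degIn univ v : ℝ) + #W ≤ n + #(({z | G.Adj v z} : Finset V) ∩ W) := by
      have : G.degIn univ v + #W ≤ n + #(({z | G.Adj v z} : Finset V) ∩ W) := by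
        have : G.degIn univ v = #{z | G.Adj v z} := rfl
        omega
      exact_mod_cast this
    have h13 : (#(({z | G.Adj v z} : Finset V) ∩ W) : ℝ) < t := by exact_mod_cast h8
    have h14 : a * n ≤ γ * a * n := by gcongr
    linarith only [h12, h13, hWc, h7, n4, h14, haεn]
  · have h1 : ε * n ≤ n := by exact mul_le_of_le_one_left hn0.le hε1
    linarith only [h1, hWc, haεn]

end Core

/-! ### Comparison with the book on the same spine -/

section Comparison

open scoped Classical
open Finset

/-- Edges outside L lie within R together with the vertices of W that have a neighbour in R. There
are at most #R of the latter, since each vertex of R has at most one neighbour in W. -/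
theorem adjPairs_compl_le {V : Type*} [Fintype V] (G : SimpleGraph V) {D : ℕ}
    (hsp : ∀ S, G.adjPairs S ≤ D * #S) {L W : Finset V} (hLW : Disjoint L W)
    (hW1 : ∀ w ∈ W, ∀ w' ∈ W, ¬ G.Adj w w')
    (hW2 : ∀ w ∈ W, ∀ w' ∈ W, w ≠ w' → ∀ r ∉ L, G.Adj r w → ¬ G.Adj r w') :
    G.adjPairs Lᶜ ≤ D * (2 * #(Lᶜ \ W)) := by
  set R := Lᶜ \ W with hR
  set N : Finset V := {w ∈ W | ∃ r ∈ R, G.Adj r w} with hN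
  have hRL : ∀ r ∈ R, r ∉ L := fun r hr => Finset.mem_compl.1 (Finset.mem_sdiff.1 hr).1
  have hsub : R ∪ N ⊆ Lᶜ := by
    refine Finset.union_subset Finset.sdiff_subset fun w hw => ?_
    rw [Finset.mem_compl]
    exact Finset.disjoint_right.1 hLW (Finset.mem_filter.1 hw).1
  have hmem : ∀ u ∈ Lᶜ, ∀ v ∈ Lᶜ, G.Adj u v → u ∈ R ∪ N := by
    intro u hu v hv huv
    by_cases huW : u ∈ W
    · refine Finset.mem_union_right _ (Finset.mem_filter.2 ⟨huW, v, ?_, huv.symm⟩)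
      exact Finset.mem_sdiff.2 ⟨hv, fun hvW => hW1 u huW v hvW huv⟩
    · exact Finset.mem_union_left _ (Finset.mem_sdiff.2 ⟨hu, huW⟩)
  have hle : G.adjPairs Lᶜ ≤ G.adjPairs (R ∪ N) := by
    rw [SimpleGraph.adjPairs, SimpleGraph.adjPairs, ← Finset.sum_subset hsub]
    · refine Finset.sum_le_sum fun u hu => Finset.card_le_card fun v hv => ?_
      rw [Finset.mem_filter] at hv ⊢
      exact ⟨hmem v hv.1 u (hsub hu) hv.2.symm, hv.2⟩
    · intro u hu hu'
      rw [SimpleGraph.degIn, Finset.card_eq_zero, Finset.filter_eq_empty_iff]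
      intro v hv huv
      exact hu' (hmem u hu v hv huv)
  have hcard : #N ≤ #R := by
    have hex : ∀ w : V, ∃ r, w ∈ N → r ∈ R ∧ G.Adj r w := by
      intro w
      by_cases hw : w ∈ N
      · obtain ⟨r, hr⟩ := (Finset.mem_filter.1 hw).2
        exact ⟨r, fun _ => hr⟩
      · exact ⟨w, fun h => absurd h hw⟩
    choose f hf using hex
    refine Finset.card_le_card_of_injOn f (fun w hw => (hf w hw).1) ?_
    intro w hw w' hw' hww
    by_contra hne
    refine hW2 w (Finset.mem_filter.1 hw).1 w' (Finset.mem_filter.1 hw').1 hne (f w)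
      (hRL _ (hf w hw).1) (hf w hw).2 ?_
    rw [hww]
    exact (hf w' hw').2
  refine hle.trans ((hsp _).trans (Nat.mul_le_mul_left _ ?_))
  have := Finset.card_union_le R N
  omega

/-- The vector equal to r on the spine and #L on the pages is an eigenvector of the book; `hr` is
the characteristic equation of the two-class quotient. -/
theorem sum_join_eigenvector {V : Type*} [Fintype V] {L : Finset V} {r : ℝ}
    (hr : r * (r - (#L - 1)) = #L * (Fintype.card V - #L)) (u : V) :
    ∑ v with u ≠ v ∧ (u ∈ L ∨ v ∈ L), (if v ∈ L then r else (#L : ℝ)) =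
      r * if u ∈ L then r else (#L : ℝ) := by
  by_cases hu : u ∈ L
  · have h1 : ({v | u ≠ v ∧ (u ∈ L ∨ v ∈ L)} : Finset V) = univ.erase u := by
      ext v
      simp [hu, eq_comm]
    have h2 := Finset.sum_erase_add univ (fun v => if v ∈ L then r else (#L : ℝ))
      (Finset.mem_univ u)
    have h3 : ∑ v : V, (if v ∈ L then r else (#L : ℝ)) = #L * r + (Fintype.card V - #L) * #L := by
      rw [Finset.sum_ite, Finset.sum_const, Finset.sum_const, nsmul_eq_mul, nsmul_eq_mul]
      have h4 : ({v | v ∈ L} : Finset V) = L := by ext; simp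
      have h5 : ({v | v ∉ L} : Finset V) = Lᶜ := by ext; simp
      rw [h4, h5, Finset.card_compl, Nat.cast_sub (Finset.card_le_univ L)]
    rw [h1]
    simp only [hu, if_true] at h2 ⊢
    linarith
  · have h1 : ({v | u ≠ v ∧ (u ∈ L ∨ v ∈ L)} : Finset V) = L := by
      ext v
      simp only [hu, false_or, Finset.mem_filter, Finset.mem_univ, true_and]
      exact ⟨fun h => h.2, fun h => ⟨fun e => hu (e ▸ h), h⟩⟩
    rw [h1, if_neg hu, Finset.sum_congr rfl (fun v hv => if_pos hv), Finset.sum_const,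
      nsmul_eq_mul, mul_comm]

/-- With A_B and A_G the adjacency matrices of the book on L and of G, and y the book's eigenvector,
xᵀ(A_B - A_G)y = (r - ρ)⟨x, y⟩ ≤ 0. Each vertex of R lacks an edge to L, contributing at least #L/2.
Pairs outside L subtract at most #L·ε·2D·#R ≤ #L·#R/4. So R is empty, and then no spine edge is
missing. -/
theorem adj_iff_of_le_spectralRadius {V : Type*} [Fintype V] (G : SimpleGraph V) {D : ℕ}
    {ε ρ r : ℝ} {x : V → ℝ} (hsp : ∀ S, G.adjPairs S ≤ D * #S) {L : Finset V} (hL : 1 ≤ #L)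
    (hW1 : ∀ w w', (∀ l ∈ L, G.Adj l w) → (∀ l ∈ L, G.Adj l w') → ¬ G.Adj w w')
    (hW2 : ∀ w w', (∀ l ∈ L, G.Adj l w) → (∀ l ∈ L, G.Adj l w') → w ≠ w' → ∀ z ∉ L, G.Adj z w →
      ¬ G.Adj z w')
    (hε : 0 ≤ ε) (hεD : 8 * D * ε ≤ 1) (hr0 : 0 < r)
    (hr : r * (r - (#L - 1)) = #L * (Fintype.card V - #L)) (hrρ : r ≤ ρ)
    (hx0 : ∀ v, 0 ≤ x v) (hx : ∀ v, ∑ u with G.Adj v u, x u = ρ * x v)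
    (hxL : ∀ l ∈ L, 1 / 2 ≤ x l) (hxε : ∀ v ∉ L, x v ≤ ε) (u v : V) :
    G.Adj u v ↔ u ≠ v ∧ (u ∈ L ∨ v ∈ L) := by
  set W : Finset V := {w | ∀ l ∈ L, G.Adj l w} with hW
  have hLW : Disjoint L W := by
    rw [Finset.disjoint_left]
    intro l hl hlW
    exact G.irrefl ((Finset.mem_filter.1 hlW).2 l hl)
  have hpairs : G.adjPairs Lᶜ ≤ D * (2 * #(Lᶜ \ W)) := by
    refine adjPairs_compl_le G hsp hLW ?_ ?_
    · intro w hw w' hw'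
      exact hW1 w w' (Finset.mem_filter.1 hw).2 (Finset.mem_filter.1 hw').2
    · intro w hw w' hw'
      exact hW2 w w' (Finset.mem_filter.1 hw).2 (Finset.mem_filter.1 hw').2
  set R := Lᶜ \ W with hR
  let y : V → ℝ := fun v => if v ∈ L then r else #L
  have hL' : (1 : ℝ) ≤ #L := by exact_mod_cast hL
  have hy0 : ∀ v, 0 < y v := by
    intro v
    by_cases hv : v ∈ L
    · simp only [y, if_pos hv]; exact hr0
    · simp only [y, if_neg hv]; linarith
  let f : V → V → ℝ := fun u v =>
    (if u ≠ v ∧ (u ∈ L ∨ v ∈ L) then x u * y v else 0) - if G.Adj u v then x u * y v else 0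
  have htot : ∑ u, ∑ v, f u v = (r - ρ) * ∑ u, x u * y u := by
    simp only [f, Finset.sum_sub_distrib, sub_mul]
    congr 1
    · rw [Finset.mul_sum]
      refine Finset.sum_congr rfl fun u _ => ?_
      rw [← Finset.sum_filter, ← Finset.mul_sum, sum_join_eigenvector hr]
      ring
    · rw [Finset.sum_comm, Finset.mul_sum]
      refine Finset.sum_congr rfl fun v _ => ?_
      rw [← Finset.sum_filter, ← Finset.sum_mul, ← mul_assoc, ← hx v]
      simp only [G.adj_comm]
  have htot0 : ∑ u, ∑ v, f u v ≤ 0 := by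
    rw [htot]
    exact mul_nonpos_of_nonpos_of_nonneg (by linarith)
      (Finset.sum_nonneg fun u _ => mul_nonneg (hx0 u) (hy0 u).le)
  have hf0 : ∀ u v, (u ∈ L ∨ v ∈ L) → 0 ≤ f u v := by
    intro u v huv
    have h0 := mul_nonneg (hx0 u) (hy0 v).le
    by_cases h1 : G.Adj u v
    · simp [f, h1, h1.ne, huv]
    · by_cases h2 : u = v <;> simp [f, h1, h2, huv, h0]
  have hfL : ∀ u ∈ L, ∀ v, u ≠ v → ¬ G.Adj u v → f u v = x u * y v := by
    intro u hu v huv h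
    simp [f, hu, huv, h]
  have hlow : -(#L * ε * G.adjPairs Lᶜ) ≤ ∑ u ∈ Lᶜ, ∑ v, f u v := by
    rw [SimpleGraph.adjPairs, Nat.cast_sum, Finset.mul_sum, ← Finset.sum_neg_distrib]
    refine Finset.sum_le_sum fun u hu => ?_
    rw [Finset.mem_compl] at hu
    calc -(#L * ε * (G.degIn Lᶜ u : ℝ)) = ∑ v ∈ Lᶜ, -(if G.Adj u v then #L * ε else 0) := by
          rw [Finset.sum_neg_distrib, ← Finset.sum_filter, Finset.sum_const, nsmul_eq_mul,
            SimpleGraph.degIn, mul_comm]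
      _ ≤ ∑ v ∈ Lᶜ, f u v := by
          refine Finset.sum_le_sum fun v hv => ?_
          rw [Finset.mem_compl] at hv
          by_cases h1 : G.Adj u v
          · simp only [f, h1, hu, hv, y, or_self, and_false, if_false, if_true, zero_sub,
              neg_le_neg_iff]
            rw [mul_comm]
            exact mul_le_mul_of_nonneg_left (hxε u hu) (by linarith)
          · simp [f, h1, hu, hv]
      _ ≤ ∑ v, f u v := by
          rw [← Finset.sum_add_sum_compl Lᶜ, compl_compl]
          have : 0 ≤ ∑ v ∈ L, f u v := Finset.sum_nonneg fun v hv => hf0 u v (Or.inr hv)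
          linarith
  have hup : ∑ u ∈ L, ∑ v, f u v ≤ #L * (#R / 4) := by
    have h1 := Finset.sum_add_sum_compl L fun u => ∑ v, f u v
    have h2 : (G.adjPairs Lᶜ : ℝ) ≤ D * (2 * #R) := by exact_mod_cast hpairs
    have h3 : #L * ε * (G.adjPairs Lᶜ : ℝ) ≤ #L * (#R / 4) := by
      rw [mul_assoc]
      refine mul_le_mul_of_nonneg_left ?_ (by linarith)
      calc ε * (G.adjPairs Lᶜ : ℝ) ≤ ε * (D * (2 * #R)) := mul_le_mul_of_nonneg_left h2 hε
        _ = (8 * D * ε) * (#R / 4) := by ring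
        _ ≤ 1 * (#R / 4) := mul_le_mul_of_nonneg_right hεD (by positivity)
        _ = _ := one_mul _
    linarith
  have hmain : (#R : ℝ) * (#L / 2) ≤ ∑ u ∈ L, ∑ v, f u v := by
    rw [Finset.sum_comm]
    calc (#R : ℝ) * (#L / 2) = ∑ v ∈ R, (#L / 2 : ℝ) := by rw [Finset.sum_const, nsmul_eq_mul]
      _ ≤ ∑ v ∈ R, ∑ u ∈ L, f u v := by
          refine Finset.sum_le_sum fun v hv => ?_
          obtain ⟨hvL, hvW⟩ := Finset.mem_sdiff.1 hv
          rw [Finset.mem_compl] at hvL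
          obtain ⟨l, hl, hlv⟩ : ∃ l ∈ L, ¬ G.Adj l v := by
            simpa [hW] using hvW
          have h1 : f l v = x l * #L := by
            rw [hfL l hl v (fun e => hvL (e ▸ hl)) hlv]
            simp only [y, if_neg hvL]
          have h2 := hxL l hl
          have h3 : f l v ≤ ∑ u ∈ L, f u v :=
            Finset.single_le_sum (f := fun u => f u v) (fun u hu => hf0 u v (Or.inl hu)) hl
          nlinarith only [h1, h2, h3, hL']
      _ ≤ ∑ v, ∑ u ∈ L, f u v := Finset.sum_le_sum_of_subset_of_nonneg (Finset.subset_univ _)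
          fun v _ _ => Finset.sum_nonneg fun u hu => hf0 u v (Or.inl hu)
  -- #R·#L/2 ≤ #R·#L/4 with #L ≥ 1.
  have hR0 : (#R : ℝ) = 0 := by
    have h0 : (0 : ℝ) ≤ #R := Nat.cast_nonneg _
    nlinarith only [hup, hmain, hL', h0]
  have hsum : ∑ u ∈ L, ∑ v, f u v = 0 := by
    refine le_antisymm ?_ ?_
    · rw [hR0] at hup
      linarith
    · rw [hR0] at hmain
      linarith
  have hadj : ∀ u ∈ L, ∀ v, u ≠ v → G.Adj u v := by
    intro u hu v huv
    by_contra hcon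
    have h1 := (Finset.sum_eq_zero_iff_of_nonneg fun u hu =>
      Finset.sum_nonneg fun v _ => hf0 u v (Or.inl hu)).1 hsum u hu
    have h2 := (Finset.sum_eq_zero_iff_of_nonneg fun v _ => hf0 u v (Or.inl hu)).1 h1 v
      (Finset.mem_univ v)
    rw [hfL u hu v huv hcon] at h2
    have h3 := hxL u hu
    have h4 := mul_pos (show 0 < x u by linarith) (hy0 v)
    linarith
  constructor
  · intro h
    refine ⟨h.ne, ?_⟩
    by_contra! hcon
    refine hW1 u v (fun l hl => hadj l hl u ?_) (fun l hl => hadj l hl v ?_) h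
    · exact fun e => hcon.1 (e ▸ hl)
    · exact fun e => hcon.2 (e ▸ hl)
  · rintro ⟨hne, hu | hv⟩
    · exact hadj u hu v hne
    · exact (hadj v hv u hne.symm).symm

end Comparison

/-! ### Books inside graphs and subdivisions inside books -/

section Books

open scoped Classical
open Finset

/-- A graph on `Fin s ⊕ Fin m` with at most one edge inside the second part has a model in any
graph in which `s` vertices have enough common neighbours, two of which are joined by a suitable
walk. -/
theorem SubdivisionModel.nonempty_of_common_neighbors {V : Type*} {G : SimpleGraph V} {s m : ℕ}
    {H : SimpleGraph (Fin s ⊕ Fin m)} (l : Fin s ↪ V) (w : Fin m ↪ V) (c : Sym2 (Fin s) ↪ V)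
    (Z : Set V) (hlw : ∀ i j, G.Adj (l i) (w j)) (hlc : ∀ i e, G.Adj (l i) (c e))
    (hwc : ∀ j e, w j ≠ c e) (hlZ : ∀ i, l i ∉ Z) (hwZ : ∀ j, w j ∉ Z) (hcZ : ∀ e, c e ∉ Z)
    (huniq : ∀ a b a' b', H.Adj (.inr a) (.inr b) → H.Adj (.inr a') (.inr b') →
      s(a, b) = s(a', b'))
    (hwalk : ∀ a b, H.Adj (.inr a) (.inr b) →
      ∃ p : G.Walk (w a) (w b), ∀ x ∈ p.support, x = w a ∨ x = w b ∨ x ∈ Z) :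
    Nonempty (SubdivisionModel H G) := by
  have hlw' : ∀ i j, l i ≠ w j := fun i j => (hlw i j).ne
  have hlc' : ∀ i e, l i ≠ c e := fun i e => (hlc i e).ne
  let b : Fin s ⊕ Fin m ↪ V := ⟨Sum.elim l w, by
    rintro (i | i) (j | j) h
    · exact congrArg _ (l.injective h)
    · exact absurd h (hlw' i j)
    · exact absurd h.symm (hlw' j i)
    · exact congrArg _ (w.injective h)⟩
  -- An edge inside the spine becomes a path of length two through its private common neighbour `c`;
  -- the only possible edge between pages runs through Z.
  refine nonempty_of_walks b
    (fun e => {x | (∃ i j, e = s(.inl i, .inl j) ∧ x = c s(i, j)) ∨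
      (∃ i j, H.Adj (.inr i) (.inr j) ∧ e = s(.inr i, .inr j) ∧ x ∈ Z)}) ?_ ?_ ?_
  · rintro (i | i) (j | j) h
    · refine ⟨.cons (hlc i s(i, j)) (hlc j s(i, j)).symm.toWalk, ?_⟩
      intro x hx
      replace hx : x ∈ (SimpleGraph.Walk.cons (hlc i s(i, j))
        (hlc j s(i, j)).symm.toWalk).support := hx
      simp only [SimpleGraph.Walk.support_cons, SimpleGraph.Walk.support_nil,
        List.mem_cons, List.not_mem_nil, or_false] at hx
      rcases hx with rfl | rfl | rfl
      · exact Or.inl rfl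
      · exact Or.inr (Or.inr (Or.inl ⟨i, j, rfl, rfl⟩))
      · exact Or.inr (Or.inl rfl)
    · refine ⟨(hlw i j).toWalk, fun x hx => ?_⟩
      replace hx : x ∈ (hlw i j).toWalk.support := hx
      simp only [SimpleGraph.Adj.support_toWalk, List.mem_cons, List.not_mem_nil, or_false] at hx
      exact hx.elim Or.inl fun h => Or.inr (Or.inl h)
    · refine ⟨(hlw j i).symm.toWalk, fun x hx => ?_⟩
      replace hx : x ∈ (hlw j i).symm.toWalk.support := hx
      simp only [SimpleGraph.Adj.support_toWalk, List.mem_cons, List.not_mem_nil, or_false] at hx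
      exact hx.elim Or.inl fun h => Or.inr (Or.inl h)
    · obtain ⟨p, hp⟩ := hwalk i j h
      refine ⟨p, fun x hx => ?_⟩
      rcases hp x hx with h1 | h1 | h1
      · exact Or.inl h1
      · exact Or.inr (Or.inl h1)
      · exact Or.inr (Or.inr (Or.inr ⟨i, j, h, rfl, h1⟩))
  · rintro u v - (k | k) (⟨i, j, -, h⟩ | ⟨i, j, -, -, h⟩)
    · exact hlc' _ _ h
    · exact hlZ _ h
    · exact hwc _ _ h
    · exact hwZ _ h
  · rintro u v u' v' - - hne x (⟨i, j, h1, h2⟩ | ⟨i, j, hij, h1, h2⟩)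
      (⟨i', j', h1', h2'⟩ | ⟨i', j', hij', h1', h2'⟩)
    · have h3 := c.injective (h2.symm.trans h2')
      refine hne (h1.trans (Eq.trans ?_ h1'.symm))
      exact congrArg (Sym2.map Sum.inl) h3
    · exact hcZ _ (h2 ▸ h2')
    · exact hcZ _ (h2' ▸ h2)
    · refine hne (h1.trans (Eq.trans ?_ h1'.symm))
      exact congrArg (Sym2.map Sum.inr) (huniq _ _ _ _ hij hij')

theorem exists_embedding_of_card_eq {V : Type*} {A : Finset V} {s : ℕ} (hA : #A = s) :
    ∃ l : Fin s ↪ V, ∀ i, l i ∈ A := by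
  let e := (Finset.equivFinOfCardEq hA).symm
  exact ⟨e.toEmbedding.trans (Function.Embedding.subtype _), fun i => (e i).2⟩

theorem exists_disjoint_embeddings {V : Type*} {B : Finset V} {α β : Type*} [Fintype α] [Fintype β]
    (hB : Fintype.card α + Fintype.card β ≤ #B) :
    ∃ (w : α ↪ V) (c : β ↪ V), (∀ i, w i ∈ B) ∧ (∀ i, c i ∈ B) ∧ ∀ i j, w i ≠ c j := by
  obtain ⟨f⟩ : Nonempty (α ⊕ β ↪ B) := by
    rw [Function.Embedding.nonempty_iff_card_le, Fintype.card_coe, Fintype.card_sum]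
    exact hB
  refine ⟨(Function.Embedding.inl.trans f).trans (Function.Embedding.subtype _),
    (Function.Embedding.inr.trans f).trans (Function.Embedding.subtype _),
    fun i => (f (.inl i)).2, fun i => (f (.inr i)).2, fun i j h => ?_⟩
  have h1 := f.injective (Subtype.ext h)
  exact Sum.inl_ne_inr h1

theorem nonempty_model_generalizedBook {V : Type*} [Fintype V] {G : SimpleGraph V} {s m : ℕ}
    {A : Finset V} (hA : #A = s)
    (hB : m + Fintype.card (Sym2 (Fin s)) ≤ #{v | ∀ a ∈ A, G.Adj a v}) :
    Nonempty (SubdivisionModel (generalizedBook s m) G) := by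
  obtain ⟨l, hl⟩ := exists_embedding_of_card_eq hA
  obtain ⟨w, c, hw, hc, hwc⟩ := exists_disjoint_embeddings (α := Fin m) (β := Sym2 (Fin s))
    (by rwa [Fintype.card_fin])
  refine SubdivisionModel.nonempty_of_common_neighbors l w c ∅
    (fun i j => (Finset.mem_filter.1 (hw j)).2 _ (hl i))
    (fun i j => (Finset.mem_filter.1 (hc j)).2 _ (hl i)) hwc (by simp) (by simp) (by simp) ?_ ?_
  · intro a b a' b' h
    exact absurd h.2 (by simp)
  · intro a b h
    exact absurd h.2 (by simp)

/-- A book together with an edge between two pages. -/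
theorem nonempty_model_generalizedBook_edge {V : Type*} [Fintype V] {G : SimpleGraph V} {s m : ℕ}
    {A : Finset V} (hA : #A = s) {i₀ i₁ : Fin m} (hi : i₀ ≠ i₁)
    (hB : m + Fintype.card (Sym2 (Fin s)) + 3 ≤ #{v | ∀ a ∈ A, G.Adj a v})
    {w₀ w₁ : V} (hw : w₀ ≠ w₁) (hw₀ : ∀ a ∈ A, G.Adj a w₀) (hw₁ : ∀ a ∈ A, G.Adj a w₁)
    (Z : Finset V) (hZ : #Z ≤ 1) (hZA : Disjoint A Z) (hZ₀ : w₀ ∉ Z) (hZ₁ : w₁ ∉ Z)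
    (p : G.Walk w₀ w₁) (hp : ∀ x ∈ p.support, x = w₀ ∨ x = w₁ ∨ x ∈ Z) :
    Nonempty (SubdivisionModel
      (generalizedBook s m ⊔ SimpleGraph.edge (.inr i₀) (.inr i₁)) G) := by
  obtain ⟨l, hl⟩ := exists_embedding_of_card_eq hA
  set B : Finset V := {v | ∀ a ∈ A, G.Adj a v} with hBdef
  -- The surplus 3 pays for removing w₀, w₁ and the at most one vertex of Z.
  have hcard : m + Fintype.card (Sym2 (Fin s)) ≤ #(B \ (insert w₀ (insert w₁ Z))) := by
    have h1 := Finset.le_card_sdiff (insert w₀ (insert w₁ Z)) B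
    have h2 := Finset.card_insert_le w₀ (insert w₁ Z)
    have h3 := Finset.card_insert_le w₁ Z
    omega
  obtain ⟨w, c, hw', hc, hwc⟩ := exists_disjoint_embeddings (α := Fin m) (β := Sym2 (Fin s))
    (by rwa [Fintype.card_fin])
  have hwm : ∀ i, (∀ a ∈ A, G.Adj a (w i)) ∧ w i ≠ w₀ ∧ w i ≠ w₁ ∧ w i ∉ Z := by
    intro i
    have := hw' i
    simpa [hBdef] using this
  have hcm : ∀ i, (∀ a ∈ A, G.Adj a (c i)) ∧ c i ≠ w₀ ∧ c i ≠ w₁ ∧ c i ∉ Z := by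
    intro i
    have := hc i
    simpa [hBdef] using this
  let f : Fin m → V := fun i => if i = i₀ then w₀ else if i = i₁ then w₁ else w i
  have hf₀ : f i₀ = w₀ := by simp [f]
  have hf₁ : f i₁ = w₁ := by simp [f, hi.symm]
  have hf : ∀ i, f i = w₀ ∧ i = i₀ ∨ f i = w₁ ∧ i = i₁ ∨ f i = w i := by
    intro i
    by_cases h1 : i = i₀
    · simp [f, h1]
    · by_cases h2 : i = i₁ <;> simp [f, h1, h2, hi.symm]
  have hfi : Function.Injective f := by
    intro i j hij
    by_contra hne
    rcases hf i with ⟨h1, h1'⟩ | ⟨h1, h1'⟩ | h1 <;> rcases hf j with ⟨h2, h2'⟩ | ⟨h2, h2'⟩ | h2 <;>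
      rw [h1, h2] at hij
    · exact hne (h1'.trans h2'.symm)
    · exact hw hij
    · exact (hwm j).2.1 hij.symm
    · exact hw hij.symm
    · exact hne (h1'.trans h2'.symm)
    · exact (hwm j).2.2.1 hij.symm
    · exact (hwm i).2.1 hij
    · exact (hwm i).2.2.1 hij
    · exact hne (w.injective hij)
  have hedge : ∀ a b : Fin m, (generalizedBook s m ⊔
      SimpleGraph.edge (.inr i₀) (.inr i₁)).Adj (.inr a) (.inr b) →
      (a = i₀ ∧ b = i₁) ∨ (a = i₁ ∧ b = i₀) := by
    intro a b h
    rcases h with h | h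
    · exact absurd h.2 (by simp)
    · rw [SimpleGraph.edge_adj] at h
      simpa using h.1
  refine SubdivisionModel.nonempty_of_common_neighbors l ⟨f, hfi⟩ c (Z : Set V)
    ?_ (fun i e => (hcm e).1 _ (hl i)) ?_ (fun i h => Finset.disjoint_left.1 hZA (hl i) h) ?_
    (fun e => (hcm e).2.2.2) ?_ ?_
  · intro i j
    change G.Adj (l i) (f j)
    rcases hf j with ⟨h, -⟩ | ⟨h, -⟩ | h <;> rw [h]
    · exact hw₀ _ (hl i)
    · exact hw₁ _ (hl i)
    · exact (hwm j).1 _ (hl i)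
  · intro j e
    change f j ≠ c e
    rcases hf j with ⟨h, -⟩ | ⟨h, -⟩ | h <;> rw [h]
    · exact (hcm e).2.1.symm
    · exact (hcm e).2.2.1.symm
    · exact hwc _ _
  · intro j
    change f j ∉ Z
    rcases hf j with ⟨h, -⟩ | ⟨h, -⟩ | h <;> rw [h]
    · exact hZ₀
    · exact hZ₁
    · exact (hwm j).2.2.2
  · intro a b a' b' h h'
    rcases hedge a b h with ⟨rfl, rfl⟩ | ⟨rfl, rfl⟩ <;>
      rcases hedge a' b' h' with ⟨rfl, rfl⟩ | ⟨rfl, rfl⟩ <;> simp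
  · intro a b h
    change ∃ p : G.Walk (f a) (f b), ∀ x ∈ p.support, x = f a ∨ x = f b ∨ x ∈ Z
    rcases hedge a b h with ⟨rfl, rfl⟩ | ⟨rfl, rfl⟩
    · rw [hf₀, hf₁]
      exact ⟨p, hp⟩
    · rw [hf₀, hf₁]
      refine ⟨p.reverse, fun x hx => ?_⟩
      rw [SimpleGraph.Walk.support_reverse, List.mem_reverse] at hx
      have := hp x hx
      tauto

/-- Every graph is a subgraph of a book whose spine is the complement of a maximum independent
set. -/
theorem nonempty_model_of_indepNum {h s : ℕ} (H : SimpleGraph (Fin h))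
    (hs : s + H.indepNum = h) :
    Nonempty (SubdivisionModel H (generalizedBook s H.indepNum)) := by
  obtain ⟨I, hI⟩ := H.exists_isNIndepSet_indepNum
  have h1 : #Iᶜ = s := by
    rw [Finset.card_compl, Fintype.card_fin, hI.card_eq]
    omega
  have h2 : #Iᶜᶜ = H.indepNum := by rw [compl_compl, hI.card_eq]
  let e := finSumEquivOfFinset h1 h2
  have he : ∀ i, e (.inr i) ∈ I := by
    intro i
    have : e (.inr i) ∈ Iᶜᶜ := by
      simp only [e, finSumEquivOfFinset_inr]
      exact Finset.orderEmbOfFin_mem _ h2 i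
    rwa [compl_compl] at this
  refine SubdivisionModel.nonempty_of_hom ⟨e.symm, ?_⟩ e.symm.injective
  intro a b hab
  refine ⟨fun h => hab.ne (e.symm.injective h), ?_⟩
  rcases ha : e.symm a with i | i
  · simp
  rcases hb : e.symm b with j | j
  · simp
  have ha' : a ∈ I := by rw [← e.apply_symm_apply a, ha]; exact he i
  have hb' : b ∈ I := by rw [← e.apply_symm_apply b, hb]; exact he j
  exact absurd hab (hI.isIndepSet ha' hb' hab.ne)

/-- The vertex cover number of a graph is at most that of its subdivisions. -/
theorem SubdivisionModel.le_add_indepNum {h s m : ℕ} {H : SimpleGraph (Fin h)}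
    (M : SubdivisionModel H (generalizedBook s m)) : h ≤ s + H.indepNum := by
  rcases Nat.eq_zero_or_pos h with rfl | hpos
  · exact Nat.zero_le _
  -- Charge each spine vertex to the vertex of H it represents or, if it is inside a path, to an end
  -- of the corresponding edge. The vertices of H that receive no charge turn out to be independent,
  -- and at most s are charged.
  let P : Fin s → Fin h → Prop := fun i u =>
    M.branch u = .inl i ∨ (∀ w, M.branch w ≠ .inl i) ∧
      ∃ v, ∃ hv : H.Adj u v, .inl i ∈ (M.path u v hv).support
  have hex : ∀ i, ∃ u, (∃ u', P i u') → P i u := by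
    intro i
    by_cases hi : ∃ u', P i u'
    · obtain ⟨u, hu⟩ := hi
      exact ⟨u, fun _ => hu⟩
    · exact ⟨⟨0, hpos⟩, fun h => absurd h hi⟩
  choose g hg using hex
  have hbranch : ∀ i u, M.branch u = .inl i → g i = u := by
    intro i u hu
    rcases hg i ⟨u, Or.inl hu⟩ with h1 | ⟨h1, -⟩
    · exact M.branch.injective (h1.trans hu.symm)
    · exact absurd hu (h1 u)
  have hindep : H.IsIndepSet ((univ.image g)ᶜ : Finset (Fin h)) := by
    intro u hu v hv _ huv
    have hu' : ∀ i, g i ≠ u := by simpa using hu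
    have hv' : ∀ i, g i ≠ v := by simpa using hv
    rcases hbu : M.branch u with i | i
    · exact hu' i (hbranch i u hbu)
    rcases hbv : M.branch v with j | j
    · exact hv' j (hbranch j v hbv)
    have hne : M.branch u ≠ M.branch v := fun e => huv.ne (M.branch.injective e)
    have hadj := (M.path u v huv).adj_snd (SimpleGraph.Walk.not_nil_of_ne hne)
    have hmem : (M.path u v huv).snd ∈ (M.path u v huv).support :=
      SimpleGraph.Walk.getVert_mem_support _ _
    -- A path starting at a page enters the spine at once. Its second vertex k is inner, and by
    -- disjointness k can be charged only to u or v.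
    rcases hs : (M.path u v huv).snd with k | k
    · rw [hs] at hmem
      have hnb : ∀ w, M.branch w ≠ .inl k := by
        intro w hw
        rw [← hw] at hmem
        rcases M.branch_mem u v huv w hmem with rfl | rfl
        · rw [hbu] at hw
          exact Sum.inr_ne_inl hw
        · rw [hbv] at hw
          exact Sum.inr_ne_inl hw
      rcases hg k ⟨u, Or.inr ⟨hnb, v, huv, hmem⟩⟩ with h1 | ⟨-, z, hz, h1⟩
      · exact hnb _ h1
      · by_cases he : s(g k, z) = s(u, v)
        · have : g k ∈ s(u, v) := he ▸ Sym2.mem_mk_left _ _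
          rcases Sym2.mem_iff.1 this with h2 | h2
          · exact hu' k h2
          · exact hv' k h2
        · obtain ⟨w, hw⟩ := M.disjoint _ _ hz _ _ huv he _ h1 hmem
          exact hnb w hw
    · rw [hs, hbu] at hadj
      exact absurd hadj.2 (by simp)
  have h1 := hindep.card_le_indepNum
  rw [Finset.card_compl, Fintype.card_fin] at h1
  have h2 : #(univ.image g) ≤ s := by
    simpa using Finset.card_image_le (s := (univ : Finset (Fin s))) (f := g)
  omega

theorem subdivisionFree_generalizedBook {F : Set FinGraph} (hF : 1 ≤ familyGamma F) (m : ℕ) :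
    SubdivisionFree F (generalizedBook (familyGamma F) m) := by
  intro H hH hcon
  obtain ⟨M⟩ := containsSubdivision_iff.1 hcon
  have h1 := M.le_add_indepNum
  have h2 : familyGamma F ≤ graphGamma H := Nat.sInf_le ⟨H, hH, rfl⟩
  rw [graphGamma] at h2
  omega

end Books

/-! ### The extremal graph for a general family -/

section Extremal

open scoped Classical
open Finset

theorem le_graphSpectralRadius_generalizedBook {s m : ℕ} (hs : 1 ≤ s) {r : ℝ} (hr0 : 0 < r)
    (hr : r * (r - (s - 1)) = s * m) :
    ENNReal.ofReal r ≤ graphSpectralRadius (generalizedBook s m) := by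
  set L : Finset (Fin s ⊕ Fin m) := {v | v.isLeft} with hL
  have hmem : ∀ v, v ∈ L ↔ v.isLeft := by simp [hL]
  have hcard : #L = s := by
    have : L = univ.map Function.Embedding.inl := by
      ext v
      rcases v with v | v <;> simp [hL]
    rw [this, Finset.card_map, Finset.card_univ, Fintype.card_fin]
  refine ofReal_le_graphSpectralRadius _ (y := fun v => if v ∈ L then r else (#L : ℝ)) ?_ ?_
  · intro h0
    have h1 := congrFun h0 (.inl ⟨0, hs⟩)
    simp only [hmem, Sum.isLeft_inl, if_true, Pi.zero_apply] at h1
    exact hr0.ne' h1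
  · intro u
    have h1 : r * (r - (#L - 1)) = #L * (Fintype.card (Fin s ⊕ Fin m) - #L) := by
      rw [hcard, hr]
      simp
    convert sum_join_eigenvector h1 u using 2
    · ext v
      simp only [Finset.mem_filter, Finset.mem_univ, true_and, hmem]
      rfl
    · congr
    · congr

theorem exists_pos_root {s m : ℝ} (hs : 1 ≤ s) (hm : 0 < m) :
    ∃ r : ℝ, 0 < r ∧ r * (r - (s - 1)) = s * m := by
  have h0 : 0 ≤ (s - 1) ^ 2 + 4 * (s * m) := by positivity
  have h1 := Real.sq_sqrt h0
  have h2 : 0 < √((s - 1) ^ 2 + 4 * (s * m)) := Real.sqrt_pos.2 (by positivity)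
  refine ⟨(s - 1 + √((s - 1) ^ 2 + 4 * (s * m))) / 2, by linarith, ?_⟩
  linarith

theorem subdivisionFree_iff {V : Type*} {F : Set FinGraph} {G : SimpleGraph V} :
    SubdivisionFree F G ↔ ∀ H ∈ F, ¬ Nonempty (SubdivisionModel H.2 G) := by
  simp only [SubdivisionFree, containsSubdivision_iff]

theorem subdivisionFree_of_iso {V V' : Type*} {F : Set FinGraph} {G : SimpleGraph V}
    {G' : SimpleGraph V'} (e : G ≃g G') (h : SubdivisionFree F G') : SubdivisionFree F G := by
  rw [subdivisionFree_iff] at h ⊢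
  rintro H hH ⟨M⟩
  obtain ⟨M'⟩ := SubdivisionModel.nonempty_of_hom e.toHom e.injective
  exact h H hH (M.nonempty_trans M')

theorem exists_mem_graphGamma_eq {F : Set FinGraph} (hF : 1 ≤ familyGamma F) :
    ∃ H ∈ F, graphGamma H = familyGamma F := by
  have hne : (graphGamma '' F).Nonempty := by
    by_contra h
    rw [Set.not_nonempty_iff_eq_empty] at h
    rw [familyGamma, h, Nat.sInf_empty] at hF
    omega
  exact Nat.sInf_mem hne

/-- Edges and common neighbours outside the spine create forbidden subdivisions. -/
theorem not_walk_of_subdivisionFree {V : Type*} [Fintype V] {F : Set FinGraph} {s m : ℕ}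
    (hm : 2 ≤ m) (hsat : SubdivisionSaturated F (generalizedBook s m)) {G : SimpleGraph V}
    (hG : SubdivisionFree F G) {A : Finset V} (hA : #A = s)
    (hB : m + Fintype.card (Sym2 (Fin s)) + 3 ≤ #{v | ∀ a ∈ A, G.Adj a v})
    {w₀ w₁ : V} (hw : w₀ ≠ w₁) (hw₀ : ∀ a ∈ A, G.Adj a w₀) (hw₁ : ∀ a ∈ A, G.Adj a w₁)
    (Z : Finset V) (hZ : #Z ≤ 1) (hZA : Disjoint A Z) (hZ₀ : w₀ ∉ Z) (hZ₁ : w₁ ∉ Z)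
    (p : G.Walk w₀ w₁) : ¬ ∀ x ∈ p.support, x = w₀ ∨ x = w₁ ∨ x ∈ Z := by
  intro hp
  have hi : (⟨0, by omega⟩ : Fin m) ≠ ⟨1, by omega⟩ := by simp
  obtain ⟨H, hH, hHc⟩ := hsat.2 (.inr ⟨0, by omega⟩) (.inr ⟨1, by omega⟩)
    (fun h => hi (Sum.inr_injective h)) (fun h => absurd h.2 (by simp))
  obtain ⟨M⟩ := containsSubdivision_iff.1 hHc
  obtain ⟨M'⟩ := nonempty_model_generalizedBook_edge hA hi hB hw hw₀ hw₁ Z hZ hZA hZ₀ hZ₁ p hp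
  exact subdivisionFree_iff.1 hG H hH (M.nonempty_trans M')

theorem nonempty_iso_generalizedBook {n s : ℕ} {G : SimpleGraph (Fin n)} {L : Finset (Fin n)}
    (hL : #L = s) (h : ∀ u v, G.Adj u v ↔ u ≠ v ∧ (u ∈ L ∨ v ∈ L)) :
    Nonempty (G ≃g generalizedBook s (n - s)) := by
  have hLc : #Lᶜ = n - s := by rw [Finset.card_compl, Fintype.card_fin, hL]
  let e := finSumEquivOfFinset hL hLc
  have hmem : ∀ x, e x ∈ L ↔ x.isLeft := by
    rintro (i | i)
    · simp only [e, finSumEquivOfFinset_inl, Sum.isLeft_inl, iff_true]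
      exact Finset.orderEmbOfFin_mem _ hL i
    · simp only [e, finSumEquivOfFinset_inr, Sum.isLeft_inr, Bool.false_eq_true, iff_false]
      exact Finset.mem_compl.1 (Finset.orderEmbOfFin_mem _ hLc i)
  refine ⟨(⟨e, ?_⟩ : generalizedBook s (n - s) ≃g G).symm⟩
  intro x y
  rw [h, hmem, hmem, e.injective.ne_iff]
  rfl

/-- The forbidden configurations are supplied by one saturated book of fixed size n₀, which keeps
the threshold dependent on F alone. If there is no such book, the claim is vacuous for large n. -/
theorem exists_forall_adj_iff {F : Set FinGraph} (hF : 1 ≤ familyGamma F) :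
    ∃ N : ℕ, ∀ n : ℕ, N ≤ n →
      SubdivisionSaturated F (generalizedBook (familyGamma F) (n - familyGamma F)) →
      ∀ (V : Type) [Fintype V], Fintype.card V = n → ∀ G : SimpleGraph V, SubdivisionFree F G →
        graphSpectralRadius (generalizedBook (familyGamma F) (n - familyGamma F)) ≤
          graphSpectralRadius G →
        ∃ L : Finset V, #L = familyGamma F ∧ ∀ u v, G.Adj u v ↔ u ≠ v ∧ (u ∈ L ∨ v ∈ L) := by
  obtain ⟨H₀, hH₀, hγ⟩ := exists_mem_graphGamma_eq hF
  set γ := familyGamma F with hγdef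
  by_cases hsat₀ : ∃ n₀, γ + 2 ≤ n₀ ∧ SubdivisionSaturated F (generalizedBook γ (n₀ - γ))
  swap
  · exact ⟨γ + 2, fun n hn hsat => absurd ⟨n, hn, hsat⟩ hsat₀⟩
  obtain ⟨n₀, hn₀, hsat₀⟩ := hsat₀
  obtain ⟨D, hD1, hD⟩ : ∃ D : ℕ, 1 ≤ D ∧ ∀ (V : Type) (G : SimpleGraph V), SubdivisionFree F G →
      ∀ S, G.adjPairs S ≤ D * #S := by
    refine ⟨2 ^ Fintype.card (Sym2 (Fin H₀.1)) * (Fintype.card (Fin H₀.1) + 1),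
      Nat.mul_pos (by positivity) (by omega), fun V G hG S => ?_⟩
    rcases S.eq_empty_or_nonempty with rfl | hS
    · simp [SimpleGraph.adjPairs]
    · by_contra! hcon
      exact subdivisionFree_iff.1 hG H₀ hH₀
        (SubdivisionModel.nonempty_of_dense H₀.2 G S hS hcon.le)
  obtain ⟨t, ht⟩ : ∃ t : ℕ, ∀ (V : Type) [Fintype V] (G : SimpleGraph V), SubdivisionFree F G →
      ∀ A : Finset V, #A = γ + 1 → #{v | ∀ a ∈ A, G.Adj a v} < t := by
    -- Enough common neighbours for the pages of a book containing H₀ and for the detours replacing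
    -- its spine edges.
    refine ⟨H₀.2.indepNum + Fintype.card (Sym2 (Fin (γ + 1))), fun V _ G hG A hA => ?_⟩
    by_contra! hcon
    rw [graphGamma] at hγ
    obtain ⟨M⟩ := nonempty_model_of_indepNum (s := γ + 1) H₀.2 (by omega)
    obtain ⟨M'⟩ := nonempty_model_generalizedBook hA hcon
    exact subdivisionFree_iff.1 hG H₀ hH₀ (M.nonempty_trans M')
  have hDpos : (1 : ℝ) ≤ D := by exact_mod_cast hD1
  obtain ⟨N, hN⟩ := exists_dominating_set (t := t) hF hD1 (ε := 1 / (8 * D)) (by positivity)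
    (by rw [div_le_one (by positivity)]; linarith)
  refine ⟨N + (γ + 2) + 2 * (n₀ + Fintype.card (Sym2 (Fin γ)) + 3), ?_⟩
  intro n hn hsat V _ hV G hG hrad
  have : Nonempty V := Fintype.card_pos_iff.1 (by omega)
  obtain ⟨ρ, x, hρ, hρrad, hx0, hxne, hx⟩ := exists_nonneg_eigenvector G
  obtain ⟨v₀, -, hv₀⟩ := Finset.exists_max_image univ x Finset.univ_nonempty
  have hpos : 0 < x v₀ := by
    obtain ⟨v, hv⟩ := Function.ne_iff.1 hxne
    exact ((hx0 v).lt_of_ne' hv).trans_le (hv₀ v (Finset.mem_univ v))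
  have hγR : (1 : ℝ) ≤ γ := by exact_mod_cast hF
  have hγn : γ + 2 ≤ n := by omega
  have hnR : ((n - γ : ℕ) : ℝ) = n - γ := by rw [Nat.cast_sub (by omega)]
  have hnpos : (0 : ℝ) < (n - γ : ℕ) := by
    have : 0 < n - γ := by omega
    exact_mod_cast this
  obtain ⟨r, hr0, hr⟩ := exists_pos_root hγR hnpos
  have hrρ : r ≤ ρ := by
    have h1 := (le_graphSpectralRadius_generalizedBook hF hr0 hr).trans hrad
    rw [hρrad] at h1
    exact (ENNReal.ofReal_le_ofReal_iff hρ).1 h1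
  have hρ2 : γ * (n - γ : ℝ) ≤ ρ ^ 2 := by
    rw [← hnR, ← hr]
    nlinarith
  -- The Perron vector is scaled to maximum 1.
  let y : V → ℝ := fun v => x v / x v₀
  have hy0 : ∀ v, 0 ≤ y v := fun v => div_nonneg (hx0 v) hpos.le
  have hy : ∀ v, ∑ u with G.Adj v u, y u = ρ * y v := by
    intro v
    simp only [y]
    rw [← Finset.sum_div, hx v, mul_div_assoc]
  obtain ⟨L, hLc, hLx, hLε, hLW⟩ := hN n (by omega) V hV G ρ y
    (hD _ G hG) (ht _ G hG) hρ hρ2 hy0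
    (fun v => (div_le_one hpos).2 (hv₀ v (Finset.mem_univ v))) ⟨v₀, div_self hpos.ne'⟩ hy
  have hW : (n₀ - γ) + Fintype.card (Sym2 (Fin γ)) + 3 ≤ #{v | ∀ a ∈ L, G.Adj a v} := by
    have h1 : 2 * (n₀ + Fintype.card (Sym2 (Fin γ)) + 3) ≤ n := by omega
    have h2 : 2 * ((n₀ + Fintype.card (Sym2 (Fin γ)) + 3 : ℕ) : ℝ) ≤ n := by exact_mod_cast h1
    have h3 : ((n₀ + Fintype.card (Sym2 (Fin γ)) + 3 : ℕ) : ℝ) ≤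
        #{v | ∀ a ∈ L, G.Adj a v} := by linarith
    have h4 := Nat.cast_le.1 h3
    omega
  -- The first two open goals say that an edge between common neighbours w, w', or a path w z w'
  -- with z off the spine, acts as a page edge of the saturated book.
  refine ⟨L, hLc, adj_iff_of_le_spectralRadius G (ρ := ρ) (r := r)
    (ε := 1 / (8 * D)) (x := y) (hD _ G hG) (hLc ▸ hF) ?_ ?_ (by positivity) ?_ hr0 ?_ hrρ hy0 hy
    hLx hLε⟩
  · intro w w' hw hw' hadj
    refine not_walk_of_subdivisionFree (by omega) hsat₀ hG hLc hW hadj.ne hw hw' ∅ (by simp)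
      (by simp) (by simp) (by simp) hadj.toWalk ?_
    simp
  · intro w w' hw hw' hne z hz hzw hzw'
    refine not_walk_of_subdivisionFree (by omega) hsat₀ hG hLc hW hne hw hw' {z} (by simp)
      (by simpa using hz) (by simpa using hzw.ne') (by simpa using hzw'.ne')
      (.cons hzw.symm hzw'.toWalk) ?_
    simp
  · rw [mul_one_div_cancel (by positivity)]
  · rw [hLc, hV, hr, hnR]

theorem exists_forall_iso_generalizedBook {F : Set FinGraph} (hF : 1 ≤ familyGamma F) :
    ∃ N : ℕ, ∀ n : ℕ, N ≤ n →
      SubdivisionSaturated F (generalizedBook (familyGamma F) (n - familyGamma F)) →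
      ∀ G : SimpleGraph (Fin n), SubdivisionFree F G →
        graphSpectralRadius (generalizedBook (familyGamma F) (n - familyGamma F)) ≤
          graphSpectralRadius G →
        Nonempty (G ≃g generalizedBook (familyGamma F) (n - familyGamma F)) := by
  obtain ⟨N, hN⟩ := exists_forall_adj_iff hF
  refine ⟨N, fun n hn hsat G hG hrad => ?_⟩
  obtain ⟨L, hL, hadj⟩ := hN n hn hsat (Fin n) (Fintype.card_fin n) G hG hrad
  exact nonempty_iso_generalizedBook hL hadj

theorem mem_spexSub_iff_of_saturated {F : Set FinGraph} (hF : 1 ≤ familyGamma F) :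
    ∃ N : ℕ, ∀ n : ℕ, N ≤ n →
      SubdivisionSaturated F (generalizedBook (familyGamma F) (n - familyGamma F)) →
      ∀ G : SimpleGraph (Fin n), G ∈ spexSub n F ↔
        Nonempty (G ≃g generalizedBook (familyGamma F) (n - familyGamma F)) := by
  obtain ⟨N, hN⟩ := exists_forall_iso_generalizedBook hF
  refine ⟨N + familyGamma F, fun n hn hsat G => ?_⟩
  have : Nonempty (Fin n) := ⟨⟨0, by omega⟩⟩
  constructor
  · rintro ⟨hfree, hmax⟩
    obtain ⟨e⟩ : Nonempty (Fin n ≃ Fin (familyGamma F) ⊕ Fin (n - familyGamma F)) :=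
      Fintype.card_eq.1 (by simp; omega)
    let B := (generalizedBook (familyGamma F) (n - familyGamma F)).comap e
    have i : B ≃g generalizedBook (familyGamma F) (n - familyGamma F) :=
      SimpleGraph.Iso.comap e _
    refine hN n (by omega) hsat G hfree ?_
    rw [← graphSpectralRadius_eq_of_iso i]
    exact hmax B (subdivisionFree_of_iso i hsat.1)
  · rintro ⟨i⟩
    refine ⟨subdivisionFree_of_iso i hsat.1, fun G' hG' => ?_⟩
    rw [graphSpectralRadius_eq_of_iso i]
    -- A graph of larger spectral radius would be isomorphic to the book as well, hence have the
    -- same radius.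
    by_contra! hcon
    obtain ⟨i'⟩ := hN n (by omega) hsat G' hG' hcon.le
    rw [graphSpectralRadius_eq_of_iso i'] at hcon
    exact lt_irrefl _ hcon

end Extremal

/-! ### Cliques, odd cycles and paths -/

section Families

open scoped Classical
open Finset

theorem graphGamma_eq {h a : ℕ} {H : SimpleGraph (Fin h)} {I : Finset (Fin h)}
    (hI : H.IsIndepSet I) (hIa : #I = a)
    (hle : ∀ J : Finset (Fin h), H.IsIndepSet J → #J ≤ a) : graphGamma ⟨h, H⟩ = h - a - 1 := by
  have h1 : H.indepNum = a := by
    refine le_antisymm ?_ (hIa ▸ hI.card_le_indepNum)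
    obtain ⟨J, hJ⟩ := H.exists_isNIndepSet_indepNum
    rw [← hJ.card_eq]
    exact hle J hJ.isIndepSet
  simp only [graphGamma, h1]

theorem graphGamma_completeGraph {r : ℕ} (hr : 1 ≤ r) :
    graphGamma ⟨r, SimpleGraph.completeGraph (Fin r)⟩ = r - 2 := by
  rw [graphGamma_eq (I := {⟨0, hr⟩}) (a := 1)]
  · omega
  · simp [SimpleGraph.IsIndepSet]
  · simp
  · intro J hJ
    rw [Finset.card_le_one]
    intro a ha b hb
    by_contra hab
    exact hJ ha hb hab hab

theorem cycleGraph_adj_val {n : ℕ} {u v : Fin n} (h : (SimpleGraph.cycleGraph n).Adj u v) :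
    (u : ℕ) + 1 = v ∨ (v : ℕ) + 1 = u ∨ ((u : ℕ) = 0 ∧ (v : ℕ) + 1 = n) ∨
      ((v : ℕ) = 0 ∧ (u : ℕ) + 1 = n) := by
  have key : ∀ a b : Fin n, (a - b).val = 1 →
      (b : ℕ) + 1 = a ∨ ((a : ℕ) = 0 ∧ (b : ℕ) + 1 = n) := by
    intro a b hab
    rcases le_or_gt b a with h1 | h1
    · rw [Fin.sub_val_of_le h1] at hab
      have : (b : ℕ) ≤ a := h1
      omega
    · rw [Fin.coe_sub_iff_lt.2 h1] at hab
      omega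
  rw [SimpleGraph.cycleGraph_adj'] at h
  rcases h with h | h
  · have := key _ _ h
    tauto
  · have := key _ _ h
    tauto

/-- The even numbers `0, 2, …, 2 (l - 1)` in `Fin n`. -/
noncomputable def evenFinset {n l : ℕ} (h : 2 * l ≤ n) : Finset (Fin n) :=
  univ.image fun j : Fin l => ⟨2 * j, by omega⟩

theorem card_evenFinset {n l : ℕ} (h : 2 * l ≤ n) : #(evenFinset h) = l := by
  rw [evenFinset, Finset.card_image_of_injective, Finset.card_univ, Fintype.card_fin]
  intro i j hij
  have : 2 * (i : ℕ) = 2 * j := congrArg Fin.val hij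
  exact Fin.ext (by omega)

theorem mem_evenFinset {n l : ℕ} {h : 2 * l ≤ n} {u : Fin n} (hu : u ∈ evenFinset h) :
    (u : ℕ) % 2 = 0 ∧ (u : ℕ) + 2 ≤ 2 * l := by
  obtain ⟨j, -, rfl⟩ := Finset.mem_image.1 hu
  simp only
  omega

/-- An independent set is disjoint from its shift by one, so it has at most half of the 2l + 1
vertices; the even numbers below 2l attain this. -/
theorem graphGamma_cycleGraph {l : ℕ} (hl : 1 ≤ l) :
    graphGamma ⟨2 * l + 1, SimpleGraph.cycleGraph (2 * l + 1)⟩ = l := by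
  rw [graphGamma_eq (I := evenFinset (l := l) (by omega)) (a := l)]
  · omega
  · intro u hu v hv _ huv
    have h1 := mem_evenFinset hu
    have h2 := mem_evenFinset hv
    have h3 := cycleGraph_adj_val huv
    omega
  · exact card_evenFinset _
  · intro J hJ
    obtain ⟨k, rfl⟩ : ∃ k, l = k + 1 := ⟨l - 1, by omega⟩
    have h1 : Disjoint J (J.image (· + 1)) := by
      rw [Finset.disjoint_left]
      intro u hu hu'
      obtain ⟨v, hv, rfl⟩ := Finset.mem_image.1 hu'
      have hadj : (SimpleGraph.cycleGraph (2 * k + 1 + 2)).Adj v (v + 1) := by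
        rw [SimpleGraph.cycleGraph_adj]
        right
        simp
      exact hJ hv hu hadj.ne hadj
    have h2 : #(J.image (· + 1)) = #J :=
      Finset.card_image_of_injective _ (add_left_injective 1)
    have h3 := Finset.card_union_of_disjoint h1
    have h4 := Finset.card_le_univ (J ∪ J.image (· + 1))
    rw [Fintype.card_fin] at h4
    omega

/-- An independent set meets each pair {2i, 2i+1} at most once. -/
theorem graphGamma_pathGraph (k : ℕ) :
    graphGamma ⟨2 * k, SimpleGraph.pathGraph (2 * k)⟩ = k - 1 := by
  rw [graphGamma_eq (I := evenFinset (l := k) le_rfl) (a := k)]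
  · omega
  · intro u hu v hv _ huv
    have h1 := mem_evenFinset hu
    have h2 := mem_evenFinset hv
    have h3 := SimpleGraph.pathGraph_adj.1 huv
    omega
  · exact card_evenFinset _
  · intro J hJ
    have h1 : #J ≤ #(Finset.range k) := by
      refine Finset.card_le_card_of_injOn (fun u : Fin (2 * k) => (u : ℕ) / 2) ?_ ?_
      · intro u _
        simp only [Finset.coe_range, Set.mem_Iio]
        omega
      · intro u hu v hv huv
        by_contra hne
        refine hJ hu hv hne (SimpleGraph.pathGraph_adj.2 ?_)
        have : (u : ℕ) ≠ v := fun h => hne (Fin.ext h)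
        simp only at huv
        omega
    rwa [Finset.card_range] at h1

/-- The vertices of a path that alternates between the two sides of a book, after a first step
between two pages. -/
def bookPath {s m : ℕ} (hs : 1 ≤ s) (i j : Fin m) (w : Fin s → Fin m) (k : Fin (2 * s + 2)) :
    Fin s ⊕ Fin m :=
  if (k : ℕ) = 0 then .inr i else if (k : ℕ) = 1 then .inr j else
    if (k : ℕ) % 2 = 0 then .inl ⟨(k - 2) / 2, by omega⟩ else .inr (w ⟨(k - 3) / 2, by omega⟩)

section BookPath

variable {s m : ℕ} (hs : 1 ≤ s) {i j : Fin m} {w : Fin s → Fin m}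

theorem bookPath_cases (k : Fin (2 * s + 2)) :
    ((k : ℕ) = 0 ∧ bookPath hs i j w k = .inr i) ∨ ((k : ℕ) = 1 ∧ bookPath hs i j w k = .inr j) ∨
      (∃ a : Fin s, (k : ℕ) = 2 * a + 2 ∧ bookPath hs i j w k = .inl a) ∨
      ∃ a : Fin s, (k : ℕ) = 2 * a + 3 ∧ bookPath hs i j w k = .inr (w a) := by
  unfold bookPath
  split_ifs with h1 h2 h3
  · exact Or.inl ⟨h1, rfl⟩
  · exact Or.inr (Or.inl ⟨h2, rfl⟩)
  · exact Or.inr (Or.inr (Or.inl ⟨_, by simp only; omega, rfl⟩))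
  · exact Or.inr (Or.inr (Or.inr ⟨_, by simp only; omega, rfl⟩))

theorem bookPath_injective (hij : i ≠ j) (hw : Function.Injective w) (hwi : ∀ a, w a ≠ i)
    (hwj : ∀ a, w a ≠ j) : Function.Injective (bookPath hs i j w) := by
  intro k k' h
  rcases bookPath_cases (i := i) (j := j) (w := w) hs k with
      ⟨h1, h1'⟩ | ⟨h1, h1'⟩ | ⟨a, h1, h1'⟩ | ⟨a, h1, h1'⟩ <;>
    rcases bookPath_cases (i := i) (j := j) (w := w) hs k' with
      ⟨h2, h2'⟩ | ⟨h2, h2'⟩ | ⟨b, h2, h2'⟩ | ⟨b, h2, h2'⟩ <;>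
    rw [h1', h2'] at h <;> apply Fin.ext <;> simp only [Sum.inr.injEq, Sum.inl.injEq,
      reduceCtorEq] at h
  · omega
  · exact absurd h hij
  · exact absurd h.symm (hwi b)
  · exact absurd h.symm hij
  · omega
  · exact absurd h.symm (hwj b)
  · subst h; omega
  · exact absurd h (hwi a)
  · exact absurd h (hwj a)
  · have := hw h
    subst this; omega

theorem bookPath_isLeft {k : Fin (2 * s + 2)} (hk : (k : ℕ) % 2 = 0) (hk0 : (k : ℕ) ≠ 0) :
    (bookPath hs i j w k).isLeft := by
  rcases bookPath_cases (i := i) (j := j) (w := w) hs k with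
      ⟨h1, h1'⟩ | ⟨h1, h1'⟩ | ⟨a, h1, h1'⟩ | ⟨a, h1, h1'⟩
  · exact absurd h1 hk0
  · omega
  · rw [h1']; rfl
  · omega

theorem bookPath_adj_succ (hinj : Function.Injective (bookPath hs i j w)) (hij : i ≠ j)
    {a b : Fin (2 * s + 2)} (hab : (a : ℕ) + 1 = b) :
    (generalizedBook s m ⊔ SimpleGraph.edge (.inr i) (.inr j)).Adj
      (bookPath hs i j w a) (bookPath hs i j w b) := by
  by_cases ha : (a : ℕ) = 0
  · right
    have hb : (b : ℕ) = 1 := by omega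
    have h1 : bookPath hs i j w a = .inr i := by simp [bookPath, ha]
    have h2 : bookPath hs i j w b = .inr j := by simp [bookPath, hb]
    rw [h1, h2, SimpleGraph.edge_adj]
    exact ⟨Or.inl ⟨rfl, rfl⟩, by simpa using hij⟩
  · left
    refine ⟨fun h => ?_, ?_⟩
    · have := hinj h
      subst this
      omega
    · rcases Nat.mod_two_eq_zero_or_one a with h1 | h1
      · exact Or.inl (bookPath_isLeft hs h1 ha)
      · exact Or.inr (bookPath_isLeft hs (by omega) (by omega))

end BookPath

theorem exists_injective_avoiding {s m : ℕ} (h : s + 2 ≤ m) (i j : Fin m) :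
    ∃ w : Fin s → Fin m, Function.Injective w ∧ (∀ a, w a ≠ i) ∧ ∀ a, w a ≠ j := by
  have h1 : s ≤ #(univ \ {i, j} : Finset (Fin m)) := by
    have h2 := Finset.le_card_sdiff ({i, j} : Finset (Fin m)) univ
    have h3 : #({i, j} : Finset (Fin m)) ≤ 2 := Finset.card_le_two
    rw [Finset.card_univ, Fintype.card_fin] at h2
    omega
  obtain ⟨T, hT, hTc⟩ := Finset.exists_subset_card_eq h1
  obtain ⟨l, hl⟩ := exists_embedding_of_card_eq hTc
  have h4 : ∀ a, l a ≠ i ∧ l a ≠ j := by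
    intro a
    simpa using hT (hl a)
  exact ⟨l, l.injective, fun a => (h4 a).1, fun a => (h4 a).2⟩

theorem nonempty_model_pathGraph {s m : ℕ} (hs : 1 ≤ s) (h : s + 2 ≤ m) {i j : Fin m}
    (hij : i ≠ j) : Nonempty (SubdivisionModel (SimpleGraph.pathGraph (2 * s + 2))
      (generalizedBook s m ⊔ SimpleGraph.edge (.inr i) (.inr j))) := by
  obtain ⟨w, hw, hwi, hwj⟩ := exists_injective_avoiding h i j
  have hinj := bookPath_injective hs hij hw hwi hwj
  refine SubdivisionModel.nonempty_of_hom ⟨bookPath hs i j w, ?_⟩ hinj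
  intro a b hab
  rcases SimpleGraph.pathGraph_adj.1 hab with h1 | h1
  · exact bookPath_adj_succ hs hinj hij h1
  · exact (bookPath_adj_succ hs hinj hij h1).symm

/-- Without its last vertex `bookPath` ends on the spine, which is adjacent to the initial page i
and closes the cycle. -/
theorem nonempty_model_cycleGraph {s m : ℕ} (hs : 1 ≤ s) (h : s + 2 ≤ m) {i j : Fin m}
    (hij : i ≠ j) : Nonempty (SubdivisionModel (SimpleGraph.cycleGraph (2 * s + 1))
      (generalizedBook s m ⊔ SimpleGraph.edge (.inr i) (.inr j))) := by
  obtain ⟨w, hw, hwi, hwj⟩ := exists_injective_avoiding h i j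
  have hinj := bookPath_injective hs hij hw hwi hwj
  have hclose : ∀ a b : Fin (2 * s + 1), (a : ℕ) = 0 → (b : ℕ) + 1 = 2 * s + 1 →
      (generalizedBook s m ⊔ SimpleGraph.edge (.inr i) (.inr j)).Adj
        (bookPath hs i j w a.castSucc) (bookPath hs i j w b.castSucc) := by
    intro a b ha hb
    left
    refine ⟨fun h => ?_, Or.inr (bookPath_isLeft hs ?_ ?_)⟩
    · have h1 := congrArg Fin.val (hinj h)
      simp only [Fin.val_castSucc] at h1
      omega
    · simp only [Fin.val_castSucc]
      omega
    · simp only [Fin.val_castSucc]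
      omega
  refine SubdivisionModel.nonempty_of_hom ⟨fun a => bookPath hs i j w a.castSucc, ?_⟩
    (hinj.comp (Fin.castSucc_injective _))
  intro a b hab
  rcases cycleGraph_adj_val hab with h1 | h1 | ⟨h1, h2⟩ | ⟨h1, h2⟩
  · exact bookPath_adj_succ hs hinj hij h1
  · exact (bookPath_adj_succ hs hinj hij h1).symm
  · exact hclose a b h1 h2
  · exact (hclose b a h1 h2).symm

theorem nonempty_model_completeGraph {s m : ℕ} {i j : Fin m} (hij : i ≠ j) :
    Nonempty (SubdivisionModel (SimpleGraph.completeGraph (Fin (s + 2)))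
      (generalizedBook s m ⊔ SimpleGraph.edge (.inr i) (.inr j))) := by
  let f : Fin (s + 2) → Fin s ⊕ Fin m := Fin.cons (.inr i) (Fin.cons (.inr j) Sum.inl)
  have hf : Function.Injective f := by
    rw [Fin.cons_injective_iff, Fin.cons_injective_iff]
    refine ⟨?_, ?_, Sum.inl_injective⟩
    · rintro ⟨k, hk⟩
      revert hk
      refine Fin.cases ?_ (fun k => ?_) k
      · simpa using hij.symm
      · simp
    · simp
  have hcases : ∀ k, f k = .inr i ∨ f k = .inr j ∨ (f k).isLeft := by
    intro k
    refine Fin.cases ?_ (fun k => ?_) k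
    · exact Or.inl rfl
    · refine Fin.cases ?_ (fun k => ?_) k
      · exact Or.inr (Or.inl rfl)
      · exact Or.inr (Or.inr rfl)
  refine SubdivisionModel.nonempty_of_hom ⟨f, ?_⟩ hf
  intro a b hab
  have hne : f a ≠ f b := hf.ne hab
  by_cases hl : (f a).isLeft ∨ (f b).isLeft
  · exact Or.inl ⟨hne, hl⟩
  · right
    rw [SimpleGraph.edge_adj]
    refine ⟨?_, hne⟩
    rcases hcases a with h1 | h1 | h1 <;> rcases hcases b with h2 | h2 | h2 <;> simp_all

theorem isLeast_familyGamma_cliqueCyclePathFamily {R L K : Set ℕ} (hne : (R ∪ L ∪ K).Nonempty)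
    (hR : ∀ r ∈ R, 3 ≤ r) (hL : ∀ l ∈ L, 1 ≤ l) :
    IsLeast ((fun r : ℕ => r - 2) '' R ∪ L ∪ (fun k : ℕ => k - 1) '' K)
      (familyGamma (cliqueCyclePathFamily R L K)) := by
  have himage : graphGamma '' cliqueCyclePathFamily R L K =
      (fun r : ℕ => r - 2) '' R ∪ L ∪ (fun k : ℕ => k - 1) '' K := by
    rw [cliqueCyclePathFamily, Set.image_union, Set.image_union, Set.image_image, Set.image_image,
      Set.image_image]
    congr 1
    · congr 1
      · exact Set.image_congr fun r hr => graphGamma_completeGraph (by have := hR r hr; omega)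
      · rw [Set.image_congr fun l hl => graphGamma_cycleGraph (hL l hl), Set.image_id']
    · exact Set.image_congr fun k _ => graphGamma_pathGraph k
  rw [← himage, familyGamma]
  refine ⟨Nat.sInf_mem ?_, fun a ha => Nat.sInf_le ha⟩
  rw [himage]
  simp only [Set.union_nonempty, Set.image_nonempty] at hne ⊢
  exact hne

/-- Only two pages can be non-adjacent. A member attaining the minimum s is K_{s+2}, C_{2s+1} or
P_{2s+2}, and it appears with the new page edge; s + 2 pages suffice. -/
theorem subdivisionSaturated_cliqueCyclePathFamily {R L K : Set ℕ}
    (hR : ∀ r ∈ R, 3 ≤ r) (hK : ∀ k ∈ K, 2 ≤ k) {s m : ℕ}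
    (hs : IsLeast ((fun r : ℕ => r - 2) '' R ∪ L ∪ (fun k : ℕ => k - 1) '' K) s)
    (hsF : familyGamma (cliqueCyclePathFamily R L K) = s) (hs1 : 1 ≤ s) (hm : s + 2 ≤ m) :
    SubdivisionSaturated (cliqueCyclePathFamily R L K) (generalizedBook s m) := by
  refine ⟨hsF ▸ subdivisionFree_generalizedBook (hsF ▸ hs1) m, ?_⟩
  have hpages : ∀ i j : Fin m, i ≠ j → ∃ H ∈ cliqueCyclePathFamily R L K,
      ContainsSubdivision H.2 (generalizedBook s m ⊔ SimpleGraph.edge (.inr i) (.inr j)) := by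
    intro i j hij
    rcases hs.1 with (⟨r, hr, hrs⟩ | hl) | ⟨k, hk, hks⟩
    · obtain rfl : r = s + 2 := by
        have := hR r hr
        simp only at hrs
        omega
      exact ⟨_, Or.inl (Or.inl ⟨_, hr, rfl⟩),
        containsSubdivision_iff.2 (nonempty_model_completeGraph hij)⟩
    · exact ⟨_, Or.inl (Or.inr ⟨_, hl, rfl⟩),
        containsSubdivision_iff.2 (nonempty_model_cycleGraph hs1 hm hij)⟩
    · obtain rfl : k = s + 1 := by
        have := hK k hk
        simp only at hks
        omega
      exact ⟨_, Or.inr ⟨_, hk, rfl⟩,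
        containsSubdivision_iff.2 (nonempty_model_pathGraph hs1 hm hij)⟩
  rintro (u | i) (v | j) hne hnadj
  · exact absurd ⟨hne, Or.inl rfl⟩ hnadj
  · exact absurd ⟨hne, Or.inl rfl⟩ hnadj
  · exact absurd ⟨hne, Or.inr rfl⟩ hnadj
  · exact hpages i j fun h => hne (congrArg _ h)

end Families

theorem corollary1p4 :
    (∀ F : Set FinGraph, 1 ≤ familyGamma F →
      ∃ N : ℕ, ∀ n : ℕ, N ≤ n →
        SubdivisionSaturated F (generalizedBook (familyGamma F) (n - familyGamma F)) →
        ∀ G : SimpleGraph (Fin n), G ∈ spexSub n F ↔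
          Nonempty (G ≃g generalizedBook (familyGamma F) (n - familyGamma F))) ∧
    (∀ R L K : Set ℕ, (R ∪ L ∪ K).Nonempty →
      (∀ r ∈ R, 3 ≤ r) → (∀ l ∈ L, 1 ≤ l) → (∀ k ∈ K, 2 ≤ k) →
      IsLeast ((fun r : ℕ => r - 2) '' R ∪ L ∪ (fun k : ℕ => k - 1) '' K)
          (familyGamma (cliqueCyclePathFamily R L K)) ∧
        ∃ N : ℕ, ∀ n : ℕ, N ≤ n →
          SubdivisionSaturated (cliqueCyclePathFamily R L K)
            (generalizedBook (familyGamma (cliqueCyclePathFamily R L K))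
              (n - familyGamma (cliqueCyclePathFamily R L K))) ∧
          ∀ G : SimpleGraph (Fin n), G ∈ spexSub n (cliqueCyclePathFamily R L K) ↔
            Nonempty (G ≃g generalizedBook (familyGamma (cliqueCyclePathFamily R L K))
              (n - familyGamma (cliqueCyclePathFamily R L K)))) := by
  refine ⟨fun F hF => mem_spexSub_iff_of_saturated hF, fun R L K hne hR hL hK => ?_⟩
  have hleast := isLeast_familyGamma_cliqueCyclePathFamily (K := K) hne hR hL
  have hs1 : 1 ≤ familyGamma (cliqueCyclePathFamily R L K) := by
    rcases hleast.1 with (⟨r, hr, hrs⟩ | hl) | ⟨k, hk, hks⟩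
    · have := hR r hr
      simp only at hrs
      omega
    · exact hL _ hl
    · have := hK k hk
      simp only at hks
      omega
  obtain ⟨N, hN⟩ := mem_spexSub_iff_of_saturated hs1
  -- This makes n - γ at least γ + 2, the number of pages that saturation requires.
  refine ⟨hleast, N + 2 * familyGamma (cliqueCyclePathFamily R L K) + 2, fun n hn => ?_⟩
  have hsat := subdivisionSaturated_cliqueCyclePathFamily hR hK hleast rfl hs1
    (m := n - familyGamma (cliqueCyclePathFamily R L K)) (by omega)
  exact ⟨hsat, hN n (by omega) hsat⟩
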